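/- \textbf{Setting.} Let $n,m,\nu$ be natural numbers, $A\in\mathbb R^{n\times n}$, $B\in\mathbb R^{n\times m}$, $d\in\mathbb R^n$, where $(A,B)$ is controllable, $A$ is invertible, $B$ has full column rank and $\nu\ge n+1$. On a probability space let $\bar x$ be a random vector in $\mathbb R^n$, $\mathbf N$ an integer random variable, and $(w_t)_{t\ge1}$, $(v_t)_{t\ge 1}$ random vectors in $\mathbb R^n$ such that $(\bar x,\mathbf N)$, $(w_t)_t$, $(v_t)_t$ are mutually independent; the $w_t$ are i.i.d. with mean $0$ and covariance $\Sigma_w$, the $v_t$ are i.i.d. with mean $0$ and covariance $\Sigma_v$; $\mathbb P(2\le\mathbf N\le\nu)=1$ and $\mathbb P(\mathbf N=\nu)>0$; $\mathbb E\|\bar x\|^2<\infty$; and for every $N\in\{2,\dots,\nu\}$ with $\mathbb P(\mathbf N=N)>0$ and every $\chi\in\mathbb R^n$ there is $\rho>0$ with $\mathbb P(\|\bar x-\rho\chi\|<\epsilon\mid\mathbf N=N)>0$ for all $\epsilon>0$. \textbf{Forward problem.} For a symmetric $Q\in\mathbb R^{n\times n}$ (possibly indefinite), $q\in\mathbb R^n$,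 a horizon $N\in\{2,\dots,\nu\}$ and an initial state $x_1\in\mathbb R^n$, minimize $$J_N=\mathbb E\Big[\tfrac12x_\nu^TQx_\nu+q^Tx_\nu+\sum_{t=\nu-N+1}^{\nu-1}\big(\tfrac12x_t^TQx_t+q^Tx_t+\tfrac12\|u_t\|^2\big)\Big]$$ over measurable state feedbacks $u_t=\mu_t(x_t)$ with $\mathbb E\|u_t\|^2<\infty$, where $x_{t+1}=x_t$ and $u_t=0$ for $1\le t\le\nu-N$, and $x_{t+1}=Ax_t+Bu_t+d+w_t$ for $\nu-N+1\le t\le\nu-1$. Let $\mathscr F(I)$ be the set of pairs $(Q,q)$, with $Q$ symmetric, for which a minimizer exists for all $N\in\{2,\dots,\nu\}$ and almost every $x_1$ under the law of $\bar x$. Let $(\bar Q,\bar q)\in\mathscr F(I)$, and let $x_t,u_t$ be the states and controls of an agent that almost surely uses, for the realization of $(\bar x,\mathbf N)$, a minimizer of the forward problem with parameters $(\bar Q,\bar q)$ and $x_1=\bar x$ (chosen measurably in $\bar x$); let $y_t=x_t+v_t$. \textbf{Inverse problem.} For $z=(Q,q,P_{1:\nu},\eta_{1:\nu},\xi_{1:\nu-1})$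 let $\Psi(z)=\sum_{N=2}^{\nu}\mathbb P(\mathbf N=N)\,\mathbb E[\tilde\psi_N(z)\mid\mathbf N=N]$ with $$\begin{aligned}\tilde\psi_N(z)=\;&\tfrac12y_\nu^TP_\nu y_\nu+\eta_\nu^Ty_\nu-\tfrac12y_{\nu-N+1}^TP_{\nu-N+1}y_{\nu-N+1}-\eta_{\nu-N+1}^Ty_{\nu-N+1}\\&-\tfrac12\mathrm{tr}(P_\nu\Sigma_v)+\tfrac12\mathrm{tr}(P_{\nu-N+1}\Sigma_v)+\sum_{t=\nu-N+1}^{\nu-1}\Big(\tfrac12\xi_t-\tfrac12\mathrm{tr}(P_{t+1}dd^T)-\eta_{t+1}^Td\\&+\tfrac12y_t^TQy_t+q^Ty_t-\tfrac12\mathrm{tr}(P_{t+1}\Sigma_w)-\tfrac12\mathrm{tr}(Q\Sigma_v)\Big).\end{aligned}$$ For $\varphi>0$ call $z$ \emph{$\varphi$-feasible} if $Q$ and all $P_t$ are symmetric, $\Big\|\begin{bmatrix}Q&q\\q^T&0\end{bmatrix}\Big\|_F\le\varphi$, $\|P_t\|_F\le\varphi$ and $\|\eta_t\|<\varphi$ for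 $1\le t\le\nu$, $|\xi_t|<\varphi$ for $1\le t\le\nu-1$, $P_\nu=Q$, $\eta_\nu=q$, and for $1\le t\le\nu-1$ $$H_t=\begin{bmatrix}B^TP_{t+1}B+I&B^TP_{t+1}A&g_t\\A^TP_{t+1}B&A^TP_{t+1}A+Q-P_t&\beta_t\\g_t^T&\beta_t^T&\xi_t\end{bmatrix}\succeq0,$$ where $g_t=B^T\eta_{t+1}+B^TP_{t+1}d$ and $\beta_t=q+A^TP_{t+1}d+A^T\eta_{t+1}-\eta_t$. Let $\bar z=(\bar Q,\bar q,\bar P_{1:\nu},\bar\eta_{1:\nu},\bar\xi_{1:\nu-1})$ be generated by $\bar P_\nu=\bar Q$, $\bar\eta_\nu=\bar q$ and, for $t=\nu-1,\dots,1$, with $\bar{\mathfrak R}_t=B^T\bar P_{t+1}B+I$, $\bar g_t=B^T\bar\eta_{t+1}+B^T\bar P_{t+1}d$ and $\dagger$ the Moore--Penrose pseudo-inverse, $$\bar P_t=A^T\bar P_{t+1}A+\bar Q-A^T\bar P_{t+1}B\bar{\mathfrak R}_t^\dagger B^T\bar P_{t+1}A,\quad \bar\eta_t=(A-B\bar{\mathfrak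 R}_t^\dagger B^T\bar P_{t+1}A)^T(\bar\eta_{t+1}+\bar P_{t+1}d)+\bar q,\quad\bar\xi_t=\bar g_t^T\bar{\mathfrak R}_t^\dagger\bar g_t.$$ \textbf{Theorem.} All expectations $\mathbb E\|u_t\|^2$ and $\Psi(z)$ are expectations of integrable random variables. For every $\varphi$ and every $\varphi$-feasible $z$, $$\Psi(z)\ \ge\ -\sum_{t=1}^{\nu-1}\mathbb E\big[\tfrac12\|u_t\|^2\big].$$ Moreover there is $\varphi_0$ such that for all $\varphi\ge\varphi_0$ the point $\bar z$ is $\varphi$-feasible, attains this lower bound, and is the unique global minimizer of $\Psi$ over the $\varphi$-feasible points. -/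

import Mathlib

open MeasureTheory ProbabilityTheory Matrix

namespace IOC

noncomputable section

/-! ### Linear algebra -/

/-- The Euclidean norm of a coordinate vector. -/
def l2norm {k : ℕ} (v : Fin k → ℝ) : ℝ := ‖WithLp.toLp 2 v‖

/-- The Frobenius norm of a real matrix. -/
def frobNorm {ι κ : Type*} [Fintype ι] [Fintype κ] (M : Matrix ι κ ℝ) : ℝ :=
  (Matrix.frobeniusNormedAddCommGroup (m := ι) (n := κ) (α := ℝ)).toNorm.norm M

/-- The four Penrose equations: `X` is the Moore-Penrose pseudo-inverse of `G`. -/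
structure IsMoorePenrose {k : ℕ} (G X : Matrix (Fin k) (Fin k) ℝ) : Prop where
  mul_mul_left : G * X * G = G
  mul_mul_right : X * G * X = X
  symm_left : (G * X)ᵀ = G * X
  symm_right : (X * G)ᵀ = X * G

theorem IsMoorePenrose.unique {k : ℕ} {G X Y : Matrix (Fin k) (Fin k) ℝ}
    (hX : IsMoorePenrose G X) (hY : IsMoorePenrose G Y) : X = Y := by
  have h1 : G * X = G * Y := by
    calc G * X = (G * Y * G) * X := by rw [hY.mul_mul_left]
      _ = (G * Y)ᵀ * (G * X)ᵀ := by rw [hY.symm_left, hX.symm_left, Matrix.mul_assoc (G * Y)]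
      _ = ((G * X * G) * Y)ᵀ := by rw [← Matrix.transpose_mul, Matrix.mul_assoc (G * X)]
      _ = G * Y := by rw [hX.mul_mul_left, hY.symm_left]
  have h2 : X * G = Y * G := by
    calc X * G = X * (G * Y * G) := by rw [hY.mul_mul_left]
      _ = (X * G)ᵀ * (Y * G)ᵀ := by
        rw [hY.symm_right, hX.symm_right]; simp only [Matrix.mul_assoc]
      _ = (Y * (G * X * G))ᵀ := by
        rw [← Matrix.transpose_mul]; simp only [Matrix.mul_assoc]
      _ = Y * G := by rw [hX.mul_mul_left, hY.symm_right]
  calc X = X * G * X := hX.mul_mul_right.symm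
    _ = Y * (G * X) := by rw [h2, Matrix.mul_assoc]
    _ = Y := by rw [h1, ← Matrix.mul_assoc, hY.mul_mul_right]

theorem exists_isMoorePenrose_of_isSymm {k : ℕ} (M : Matrix (Fin k) (Fin k) ℝ)
    (hM : M.IsSymm) : ∃ Y, IsMoorePenrose M Y ∧ Y.IsSymm := by
  obtain ⟨U, e, hU, hspec⟩ : ∃ (U : Matrix (Fin k) (Fin k) ℝ) (e : Fin k → ℝ),
      Uᵀ * U = 1 ∧ M = U * diagonal e * Uᵀ := by
    have hH : M.IsHermitian := by
      rw [Matrix.IsHermitian, Matrix.conjTranspose_eq_transpose_of_trivial]; exact hM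
    refine ⟨(hH.eigenvectorUnitary : Matrix (Fin k) (Fin k) ℝ), hH.eigenvalues, ?_, ?_⟩
    · have h := Unitary.star_mul_self_of_mem hH.eigenvectorUnitary.2
      rwa [Matrix.star_eq_conjTranspose, Matrix.conjTranspose_eq_transpose_of_trivial] at h
    · have h := hH.spectral_theorem
      rw [Unitary.conjStarAlgAut_apply] at h
      simpa [Matrix.star_eq_conjTranspose, Matrix.conjTranspose_eq_transpose_of_trivial] using h
  have hmul : ∀ a b : Fin k → ℝ, (U * diagonal a * Uᵀ) * (U * diagonal b * Uᵀ)
      = U * diagonal (fun i => a i * b i) * Uᵀ := by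
    intro a b
    calc (U * diagonal a * Uᵀ) * (U * diagonal b * Uᵀ)
        = U * diagonal a * (Uᵀ * U) * diagonal b * Uᵀ := by simp only [Matrix.mul_assoc]
      _ = _ := by rw [hU, Matrix.mul_one, Matrix.mul_assoc U, Matrix.diagonal_mul_diagonal]
  have hsymm : ∀ a : Fin k → ℝ, (U * diagonal a * Uᵀ)ᵀ = U * diagonal a * Uᵀ := by
    intro a
    simp [Matrix.transpose_mul, Matrix.mul_assoc]
  refine ⟨U * diagonal (fun i => (e i)⁻¹) * Uᵀ, ⟨?_, ?_, ?_, ?_⟩, hsymm _⟩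
  · rw [hspec, hmul, hmul]; congr 3; funext i; exact mul_inv_mul_cancel _
  · rw [hspec, hmul, hmul]; congr 3; funext i
    simpa using mul_inv_mul_cancel (e i)⁻¹
  · rw [hspec, hmul, hsymm]
  · rw [hspec, hmul, hsymm]

theorem exists_isMoorePenrose {k : ℕ} (G : Matrix (Fin k) (Fin k) ℝ) :
    ∃ X, IsMoorePenrose G X := by
  obtain ⟨Y, hY, hYs⟩ := exists_isMoorePenrose_of_isSymm (Gᵀ * G)
    (by rw [Matrix.IsSymm, Matrix.transpose_mul, Matrix.transpose_transpose])
  have hG : G * (Y * (Gᵀ * G) - 1) = 0 := by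
    rw [← Matrix.conjTranspose_mul_self_mul_eq_zero,
      Matrix.conjTranspose_eq_transpose_of_trivial, Matrix.mul_sub, Matrix.mul_one,
      ← Matrix.mul_assoc, hY.mul_mul_left, sub_self]
  rw [Matrix.mul_sub, Matrix.mul_one, sub_eq_zero] at hG
  refine ⟨Y * Gᵀ, ⟨?_, ?_, ?_, ?_⟩⟩
  · simpa only [Matrix.mul_assoc] using hG
  · have h := congrArg (· * Gᵀ) hY.mul_mul_right
    simpa only [Matrix.mul_assoc] using h
  · simp only [Matrix.transpose_mul, Matrix.transpose_transpose, hYs.eq, Matrix.mul_assoc]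
  · simpa only [Matrix.mul_assoc] using hY.symm_right

/-- The Moore-Penrose pseudo-inverse of a real square matrix. -/
def pinv {k : ℕ} (G : Matrix (Fin k) (Fin k) ℝ) : Matrix (Fin k) (Fin k) ℝ :=
  (exists_isMoorePenrose G).choose

theorem pinv_spec {k : ℕ} (G : Matrix (Fin k) (Fin k) ℝ) : IsMoorePenrose G (pinv G) :=
  (exists_isMoorePenrose G).choose_spec

/-! ### The forward problem -/

/-- The data of the controlled system `x (t+1) = A x t + B u t + d + w t` and the last time
`ν`, which is also the longest planning horizon. -/
structure LinSys (n m : ℕ) where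
  A : Matrix (Fin n) (Fin n) ℝ
  B : Matrix (Fin n) (Fin m) ℝ
  d : Fin n → ℝ
  ν : ℕ

variable {n m : ℕ}

/-- Controllability of `(A, B)`: the matrix `[B, A B, …, A ^ (n-1) B]` has rank `n`. -/
def LinSys.IsControllable (S : LinSys n m) : Prop :=
  (Matrix.of fun (i : Fin n) (c : Fin n × Fin m) => (S.A ^ (c.1 : ℕ) * S.B) i c.2).rank = n

/-- A state-feedback strategy: the control applied at time `t` is a function of the state at
time `t`. -/
abbrev Policy (n m : ℕ) := ℕ → (Fin n → ℝ) → (Fin m → ℝ)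

/-- The state at time `t` for planning horizon `N`, initial state `x₁`, strategy `μ` and noise
realization `w`: the state rests at `x₁` at the times `1, …, ν - N + 1`, then follows the
dynamics. (Only the times `1, …, ν` are meaningful.) -/
def LinSys.state (S : LinSys n m) (N : ℕ) (x₁ : Fin n → ℝ) (μ : Policy n m)
    (w : ℕ → Fin n → ℝ) : ℕ → Fin n → ℝ
  | 0 => x₁
  | t + 1 =>
    if t ≤ S.ν - N then LinSys.state S N x₁ μ w t
    else S.A *ᵥ LinSys.state S N x₁ μ w t + S.B *ᵥ μ t (LinSys.state S N x₁ μ w t) + S.d + w t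

/-- The control at time `t`: zero at the times `1, …, ν - N`, the feedback afterwards. -/
def LinSys.control (S : LinSys n m) (N : ℕ) (x₁ : Fin n → ℝ) (μ : Policy n m)
    (w : ℕ → Fin n → ℝ) (t : ℕ) : Fin m → ℝ :=
  if t ≤ S.ν - N then 0 else μ t (S.state N x₁ μ w t)

section Forward

variable {Ω : Type*} [MeasurableSpace Ω]

/-- Admissible strategies: measurable feedbacks whose control signals are square integrable
(so that the, possibly indefinite, expected cost is well defined). -/
def LinSys.IsAdmissible (S : LinSys n m) (P : Measure Ω) (w : ℕ → Ω → Fin n → ℝ)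
    (N : ℕ) (x₁ : Fin n → ℝ) (μ : Policy n m) : Prop :=
  ∀ t ∈ Finset.Icc (S.ν - N + 1) (S.ν - 1),
    Measurable (μ t) ∧ MemLp (fun ω => S.control N x₁ μ (fun s => w s ω) t) 2 P

/-- The expected cost `J_N` of a strategy from the deterministic initial state `x₁`. -/
def LinSys.cost (S : LinSys n m) (P : Measure Ω) (w : ℕ → Ω → Fin n → ℝ)
    (Q : Matrix (Fin n) (Fin n) ℝ) (q : Fin n → ℝ) (R : Matrix (Fin m) (Fin m) ℝ)
    (N : ℕ) (x₁ : Fin n → ℝ) (μ : Policy n m) : ℝ :=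
  ∫ ω,
    (let x := S.state N x₁ μ (fun s => w s ω)
     let u := S.control N x₁ μ (fun s => w s ω)
     (1 / 2) * (x S.ν ⬝ᵥ Q *ᵥ x S.ν) + q ⬝ᵥ x S.ν
      + ∑ t ∈ Finset.Icc (S.ν - N + 1) (S.ν - 1),
          ((1 / 2) * (x t ⬝ᵥ Q *ᵥ x t) + q ⬝ᵥ x t + (1 / 2) * (u t ⬝ᵥ R *ᵥ u t))) ∂P

/-- `μ` solves the forward problem with parameters `(Q, q, R)`, horizon `N` and initial state
`x₁`. -/
def LinSys.IsOptimal (S : LinSys n m) (P : Measure Ω) (w : ℕ → Ω → Fin n → ℝ)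
    (Q : Matrix (Fin n) (Fin n) ℝ) (q : Fin n → ℝ) (R : Matrix (Fin m) (Fin m) ℝ)
    (N : ℕ) (x₁ : Fin n → ℝ) (μ : Policy n m) : Prop :=
  S.IsAdmissible P w N x₁ μ ∧
    ∀ μ' : Policy n m, S.IsAdmissible P w N x₁ μ' →
      S.cost P w Q q R N x₁ μ ≤ S.cost P w Q q R N x₁ μ'

/-- The set of parameters `(Q, q)`, with `Q` symmetric, for which the forward problem with
control weight `R` has a solution for every horizon `N ∈ {2, …, ν}` and almost every initial
state. -/
def LinSys.wellPosed (S : LinSys n m) (P : Measure Ω) (w : ℕ → Ω → Fin n → ℝ)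
    (xbar : Ω → Fin n → ℝ) (R : Matrix (Fin m) (Fin m) ℝ) :
    Set (Matrix (Fin n) (Fin n) ℝ × (Fin n → ℝ)) :=
  {Qq | Qq.1.IsSymm ∧ ∀ N ∈ Finset.Icc 2 S.ν, ∀ᵐ x₁ ∂(P.map xbar),
    ∃ μ : Policy n m, S.IsOptimal P w Qq.1 Qq.2 R N x₁ μ}

/-! ### The probabilistic assumptions -/

/-- The random vectors `w 1, w 2, …` are i.i.d. with mean zero and covariance matrix `Cov`. -/
structure IsIIDNoise (P : Measure Ω) (w : ℕ → Ω → Fin n → ℝ)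
    (Cov : Matrix (Fin n) (Fin n) ℝ) : Prop where
  measurable : ∀ t, 1 ≤ t → Measurable (w t)
  indep : iIndepFun (fun k : ℕ => w (k + 1)) P
  ident : ∀ s t, 1 ≤ s → 1 ≤ t → IdentDistrib (w s) (w t) P P
  memLp : ∀ t, 1 ≤ t → MemLp (w t) 2 P
  mean : ∀ t, 1 ≤ t → ∫ ω, w t ω ∂P = 0
  cov : ∀ t, 1 ≤ t → ∀ i j, covariance (fun ω => w t ω i) (fun ω => w t ω j) P = Cov i j

/-- Mutual independence of the three random elements `(xbar, N)`, `(w t)_{t ≥ 1}` and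
`(v t)_{t ≥ 1}`. -/
def MutuallyIndependent (P : Measure Ω) (xbar : Ω → Fin n → ℝ) (N : Ω → ℕ)
    (w v : ℕ → Ω → Fin n → ℝ) : Prop :=
  IndepFun (fun ω => (xbar ω, N ω))
      (fun ω => ((fun k : ℕ => w (k + 1) ω), (fun k : ℕ => v (k + 1) ω))) P ∧
    IndepFun (fun ω (k : ℕ) => w (k + 1) ω) (fun ω (k : ℕ) => v (k + 1) ω) P

/-- The conditional law given `N = k`. -/
def condHorizon (P : Measure Ω) (N : Ω → ℕ) (k : ℕ) : Measure Ω :=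
  ProbabilityTheory.cond P {ω | N ω = k}

/-- The horizon takes its values in `{2, …, ν}` almost surely, `ν ≥ n + 1`, and the longest
horizon has positive probability. -/
structure HorizonAssumption (n ν : ℕ) (P : Measure Ω) (N : Ω → ℕ) : Prop where
  measurable : Measurable N
  le : n + 1 ≤ ν
  support : ∀ᵐ ω ∂P, N ω ∈ Finset.Icc 2 ν
  pos : 0 < P {ω | N ω = ν}

/-- Persistent excitation: `xbar` has a finite second moment and, conditionally on each horizon
of positive probability, every direction `χ` has a positive multiple in the support of `xbar`. -/
structure PersistentExcitation (ν : ℕ) (P : Measure Ω) (xbar : Ω → Fin n → ℝ) (N : Ω → ℕ) :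
    Prop where
  measurable : Measurable xbar
  memLp : MemLp xbar 2 P
  excite : ∀ k ∈ Finset.Icc 2 ν, 0 < P {ω | N ω = k} → ∀ χ : Fin n → ℝ, ∃ ρ : ℝ, 0 < ρ ∧
    ∀ ε : ℝ, 0 < ε → 0 < condHorizon P N k {ω | l2norm (ρ • χ - xbar ω) < ε}

/-! ### The closed-loop behaviour of the agent

The agent uses, for the realization `(N, x₁)` of horizon and initial state, the strategy
`π N x₁`. -/

/-- The state trajectory of the agent. -/
def LinSys.agentState (S : LinSys n m) (π : ℕ → (Fin n → ℝ) → Policy n m)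
    (xbar : Ω → Fin n → ℝ) (N : Ω → ℕ) (w : ℕ → Ω → Fin n → ℝ) (t : ℕ) (ω : Ω) : Fin n → ℝ :=
  S.state (N ω) (xbar ω) (π (N ω) (xbar ω)) (fun s => w s ω) t

/-- The control signal of the agent. -/
def LinSys.agentControl (S : LinSys n m) (π : ℕ → (Fin n → ℝ) → Policy n m)
    (xbar : Ω → Fin n → ℝ) (N : Ω → ℕ) (w : ℕ → Ω → Fin n → ℝ) (t : ℕ) (ω : Ω) : Fin m → ℝ :=
  S.control (N ω) (xbar ω) (π (N ω) (xbar ω)) (fun s => w s ω) t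

/-- The noisy observations `y t = x t + v t`. -/
def LinSys.observation (S : LinSys n m) (π : ℕ → (Fin n → ℝ) → Policy n m)
    (xbar : Ω → Fin n → ℝ) (N : Ω → ℕ) (w v : ℕ → Ω → Fin n → ℝ) (t : ℕ) (ω : Ω) :
    Fin n → ℝ :=
  S.agentState π xbar N w t ω + v t ω

end Forward

/-! ### The inverse problem -/

/-- A point `(Q, q, P_{1:ν}, η_{1:ν}, ξ_{1:ν-1})`; only these ranges of the indices are used. -/
structure Candidate (n : ℕ) where
  Q : Matrix (Fin n) (Fin n) ℝ
  q : Fin n → ℝ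
  P : ℕ → Matrix (Fin n) (Fin n) ℝ
  η : ℕ → Fin n → ℝ
  ξ : ℕ → ℝ

/-- Equality of `(Q, q, P_{1:ν}, η_{1:ν}, ξ_{1:ν-1})`. -/
def Candidate.Same (ν : ℕ) (z z' : Candidate n) : Prop :=
  z.Q = z'.Q ∧ z.q = z'.q ∧ (∀ t ∈ Finset.Icc 1 ν, z.P t = z'.P t) ∧
    (∀ t ∈ Finset.Icc 1 ν, z.η t = z'.η t) ∧ ∀ t ∈ Finset.Icc 1 (ν - 1), z.ξ t = z'.ξ t

/-- `𝔖 = Bᵀ P₊ A`, where `P₊` stands for `P (t+1)`. -/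
def LinSys.fS (S : LinSys n m) (Pn : Matrix (Fin n) (Fin n) ℝ) : Matrix (Fin m) (Fin n) ℝ :=
  S.Bᵀ * Pn * S.A

/-- `𝔑 = Bᵀ P₊ B + R`. -/
def LinSys.fR (S : LinSys n m) (R : Matrix (Fin m) (Fin m) ℝ)
    (Pn : Matrix (Fin n) (Fin n) ℝ) : Matrix (Fin m) (Fin m) ℝ :=
  S.Bᵀ * Pn * S.B + R

/-- `g = Bᵀ η₊ + Bᵀ P₊ d`. -/
def LinSys.g (S : LinSys n m) (Pn : Matrix (Fin n) (Fin n) ℝ) (ηn : Fin n → ℝ) : Fin m → ℝ :=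
  S.Bᵀ *ᵥ ηn + S.Bᵀ *ᵥ (Pn *ᵥ S.d)

/-- `β t = q + Aᵀ P (t+1) d + Aᵀ η (t+1) - η t`. -/
def LinSys.β (S : LinSys n m) (z : Candidate n) (t : ℕ) : Fin n → ℝ :=
  z.q + S.Aᵀ *ᵥ (z.P (t + 1) *ᵥ S.d) + S.Aᵀ *ᵥ z.η (t + 1) - z.η t

/-- The block matrix `H t = [[𝔑, 𝔖, g], [𝔖ᵀ, Aᵀ P (t+1) A + Q - P t, β], [gᵀ, βᵀ, ξ t]]`. -/
def LinSys.H (S : LinSys n m) (R : Matrix (Fin m) (Fin m) ℝ) (z : Candidate n) (t : ℕ) :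
    Matrix (Fin m ⊕ (Fin n ⊕ Unit)) (Fin m ⊕ (Fin n ⊕ Unit)) ℝ :=
  Matrix.fromBlocks
    (S.fR R (z.P (t + 1)))
    (Matrix.fromCols (S.fS (z.P (t + 1)))
      (Matrix.replicateCol Unit (S.g (z.P (t + 1)) (z.η (t + 1)))))
    (Matrix.fromRows (S.fS (z.P (t + 1)))ᵀ
      (Matrix.replicateRow Unit (S.g (z.P (t + 1)) (z.η (t + 1)))))
    (Matrix.fromBlocks
      (S.Aᵀ * z.P (t + 1) * S.A + z.Q - z.P t)
      (Matrix.replicateCol Unit (S.β z t))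
      (Matrix.replicateRow Unit (S.β z t))
      (Matrix.of fun _ _ => z.ξ t))

/-- The compact set `𝔾(φ)` of parameters: `Q` symmetric and `‖[[Q, q], [qᵀ, 0]]‖_F ≤ φ`. -/
def paramSet (n : ℕ) (φ : ℝ) : Set (Matrix (Fin n) (Fin n) ℝ × (Fin n → ℝ)) :=
  {Qq | Qq.1.IsSymm ∧
    frobNorm (Matrix.fromBlocks Qq.1 (Matrix.replicateCol Unit Qq.2)
      (Matrix.replicateRow Unit Qq.2) 0) ≤ φ}

/-- Feasibility for the inverse optimal control problem (with control weight `I`). -/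
structure LinSys.IsFeasible (S : LinSys n m) (φ : ℝ) (z : Candidate n) : Prop where
  param : (z.Q, z.q) ∈ paramSet n φ
  P_symm : ∀ t ∈ Finset.Icc 1 S.ν, (z.P t).IsSymm
  P_le : ∀ t ∈ Finset.Icc 1 S.ν, frobNorm (z.P t) ≤ φ
  η_lt : ∀ t ∈ Finset.Icc 1 S.ν, l2norm (z.η t) < φ
  ξ_lt : ∀ t ∈ Finset.Icc 1 (S.ν - 1), |z.ξ t| < φ
  P_last : z.P S.ν = z.Q
  η_last : z.η S.ν = z.q
  H_psd : ∀ t ∈ Finset.Icc 1 (S.ν - 1), (S.H 1 z t).PosSemidef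

/-- The integrand `ψ̃_N` of the objective, at an observed trajectory `y`. -/
def LinSys.psi (S : LinSys n m) (SigW SigV : Matrix (Fin n) (Fin n) ℝ) (N : ℕ) (z : Candidate n)
    (y : ℕ → Fin n → ℝ) : ℝ :=
  (1 / 2) * (y S.ν ⬝ᵥ z.P S.ν *ᵥ y S.ν) + z.η S.ν ⬝ᵥ y S.ν
    - (1 / 2) * (y (S.ν - N + 1) ⬝ᵥ z.P (S.ν - N + 1) *ᵥ y (S.ν - N + 1))
    - z.η (S.ν - N + 1) ⬝ᵥ y (S.ν - N + 1)
    - (1 / 2) * (z.P S.ν * SigV).trace + (1 / 2) * (z.P (S.ν - N + 1) * SigV).trace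
    + ∑ t ∈ Finset.Icc (S.ν - N + 1) (S.ν - 1),
        ((1 / 2) * z.ξ t - (1 / 2) * (z.P (t + 1) * Matrix.vecMulVec S.d S.d).trace
          - z.η (t + 1) ⬝ᵥ S.d + (1 / 2) * (y t ⬝ᵥ z.Q *ᵥ y t) + z.q ⬝ᵥ y t
          - (1 / 2) * (z.P (t + 1) * SigW).trace - (1 / 2) * (z.Q * SigV).trace)

/-- The objective `Ψ = ∑_{N=2}^{ν} ℙ(N) 𝔼[ψ̃_N | N]` of the inverse problem, for the random
observations `y`. -/
def LinSys.Psi (S : LinSys n m) {Ω : Type*} [MeasurableSpace Ω] (P : Measure Ω) (N : Ω → ℕ)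
    (SigW SigV : Matrix (Fin n) (Fin n) ℝ) (y : ℕ → Ω → Fin n → ℝ) (z : Candidate n) : ℝ :=
  ∑ k ∈ Finset.Icc 2 S.ν, P.real {ω | N ω = k} *
    ∫ ω, S.psi SigW SigV k z (fun t => y t ω) ∂(condHorizon P N k)

/-- The pair `(P, η)` after `k` backward steps of the Riccati recursions with weight `R`. -/
def LinSys.riccati (S : LinSys n m) (Q : Matrix (Fin n) (Fin n) ℝ) (q : Fin n → ℝ)
    (R : Matrix (Fin m) (Fin m) ℝ) : ℕ → Matrix (Fin n) (Fin n) ℝ × (Fin n → ℝ)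
  | 0 => (Q, q)
  | k + 1 =>
    let Pn := (LinSys.riccati S Q q R k).1
    let ηn := (LinSys.riccati S Q q R k).2
    (S.Aᵀ * Pn * S.A + Q
        - S.Aᵀ * Pn * S.B * pinv (S.Bᵀ * Pn * S.B + R) * S.Bᵀ * Pn * S.A,
      (S.A - S.B * pinv (S.Bᵀ * Pn * S.B + R) * S.Bᵀ * Pn * S.A)ᵀ *ᵥ (ηn + Pn *ᵥ S.d) + q)

/-- The point generated by `(Q, q)` and control weight `I`: `P t` and `η t` are the Riccati
iterates, started at time `ν`, and `ξ t = (g t)ᵀ 𝔑_t† g t`. -/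
def LinSys.truth (S : LinSys n m) (Q : Matrix (Fin n) (Fin n) ℝ) (q : Fin n → ℝ) :
    Candidate n where
  Q := Q
  q := q
  P t := (S.riccati Q q 1 (S.ν - t)).1
  η t := (S.riccati Q q 1 (S.ν - t)).2
  ξ t :=
    let Pn := (S.riccati Q q 1 (S.ν - (t + 1))).1
    let ηn := (S.riccati Q q 1 (S.ν - (t + 1))).2
    S.g Pn ηn ⬝ᵥ pinv (S.fR 1 Pn) *ᵥ S.g Pn ηn

end

end IOC

namespace IOC

variable {n m : ℕ}

/-! Write `V_t(x) = xᵀ P_t x / 2 + η_tᵀ x`. The matrix `H t` is designed so that half its quadratic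
form at `(u, x, 1)` is the Bellman residual `V_{t+1}(Ax + Bu + d) - V_t(x)` plus the stage cost
`xᵀQx/2 + qᵀx + |u|²/2`, up to constants (`LinSys.quadFun_step`). In expectation along a closed
loop, independent centred noise adds only trace terms, which the corrections in the objective
cancel, and the sum over time telescopes. Hence `Ψ z` is the expected sum of the half-forms minus
the control effort (`LinSys.ClosedLoop.integral_psi`), and `H t ⪰ 0` gives the lower bound.

For the Riccati iterates with every `𝔑 t` positive definite, the form is a completed square, zero
exactly at the affine feedback `u = -𝔑⁻¹(𝔖x + g)`. Then optimal controls almost surely follow this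
feedback, so the true point attains the bound. Definiteness comes from solvability
(`LinSys.truth_fR_posDef`), backwards in time: perturbing the first control must keep the cost
bounded below, so `𝔑 ⪰ 0`, and a kernel vector `c` has `cᵀ(𝔖x + g) = 0` for almost every initial
state. Excitation gives `cᵀ𝔖 = 0`, invertibility of `A` gives `PBc = 0`, hence `c = 𝔑c = 0`.

For uniqueness, a feasible point attaining the bound has `H t (u, x, 1) = 0` almost surely on the
longest horizon. The closed-loop matrices are invertible, so no state `x_t` is confined to an affine
hyperplane (`LinSys.ClosedLoop.affinelyRich_state`), and the kernel equations hold for all `x`.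
Subtracting those of the true point shows that the differences of the `P` and `η` are annihilated by
`Bᵀ` and satisfy linear recursions in which the gain no longer appears. Controllability and `ν ≥ n +
1` leave only the zero solution (`LinSys.same_of_tight`). -/

theorem transpose_mulVec_dotProduct {k l : ℕ} (M : Matrix (Fin k) (Fin l) ℝ) (x : Fin k → ℝ)
    (y : Fin l → ℝ) : (Mᵀ *ᵥ x) ⬝ᵥ y = x ⬝ᵥ (M *ᵥ y) := by
  rw [dotProduct_mulVec, mulVec_transpose]

theorem dotProduct_transpose_mulVec {k l : ℕ} (M : Matrix (Fin k) (Fin l) ℝ) (x : Fin k → ℝ)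
    (y : Fin l → ℝ) : y ⬝ᵥ (Mᵀ *ᵥ x) = (M *ᵥ y) ⬝ᵥ x := by
  rw [dotProduct_comm, transpose_mulVec_dotProduct, dotProduct_comm]

theorem _root_.Matrix.IsSymm.dotProduct_mulVec_comm {k : ℕ} {M : Matrix (Fin k) (Fin k) ℝ}
    (hM : M.IsSymm) (x y : Fin k → ℝ) : x ⬝ᵥ M *ᵥ y = y ⬝ᵥ M *ᵥ x := by
  conv_lhs => rw [← hM.eq]
  rw [dotProduct_transpose_mulVec, dotProduct_comm]

theorem dotProduct_mulVec_eq_sum {k l : ℕ} (M : Matrix (Fin k) (Fin l) ℝ) (x : Fin k → ℝ)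
    (y : Fin l → ℝ) : x ⬝ᵥ M *ᵥ y = ∑ i, ∑ j, M i j * (x i * y j) := by
  simp only [dotProduct, mulVec, Finset.mul_sum]
  exact Finset.sum_congr rfl fun i _ => Finset.sum_congr rfl fun j _ => by ring

theorem trace_mul_eq_sum {k : ℕ} {M : Matrix (Fin k) (Fin k) ℝ} (hM : M.IsSymm)
    (N : Matrix (Fin k) (Fin k) ℝ) : (M * N).trace = ∑ i, ∑ j, M i j * N i j := by
  rw [Finset.sum_comm]
  simp only [Matrix.trace, Matrix.diag, Matrix.mul_apply]
  exact Finset.sum_congr rfl fun i _ => Finset.sum_congr rfl fun j _ => by rw [hM.apply]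

theorem l2norm_sq {k : ℕ} (v : Fin k → ℝ) : l2norm v ^ 2 = v ⬝ᵥ v := by
  rw [l2norm, EuclideanSpace.real_norm_sq_eq]
  simp [dotProduct, sq]

/-- Symmetric matrices have symmetric pseudo-inverses. -/
theorem pinv_isSymm {k : ℕ} {G : Matrix (Fin k) (Fin k) ℝ} (hG : G.IsSymm) :
    (pinv G).IsSymm := by
  obtain ⟨Y, hY, hs⟩ := exists_isMoorePenrose_of_isSymm G hG
  rwa [(pinv_spec G).unique hY]

theorem mul_pinv_of_posDef {k : ℕ} {G : Matrix (Fin k) (Fin k) ℝ} (hG : G.PosDef) :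
    G * pinv G = 1 := by
  have h := (pinv_spec G).mul_mul_left
  have hu : IsUnit G := hG.isUnit
  exact hu.mul_right_cancel (by rw [h, one_mul])

theorem LinSys.fR_isSymm (S : LinSys n m) {Pn : Matrix (Fin n) (Fin n) ℝ} (hP : Pn.IsSymm) :
    (S.fR 1 Pn).IsSymm := by
  simp [LinSys.fR, Matrix.IsSymm, Matrix.transpose_mul, hP.eq, Matrix.mul_assoc]

theorem LinSys.riccati_isSymm (S : LinSys n m) {Q : Matrix (Fin n) (Fin n) ℝ} (hQ : Q.IsSymm)
    (q : Fin n → ℝ) (k : ℕ) : (S.riccati Q q 1 k).1.IsSymm := by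
  induction k with
  | zero => exact hQ
  | succ k ih =>
    have hX : (pinv (S.Bᵀ * (S.riccati Q q 1 k).1 * S.B + 1)).IsSymm :=
      pinv_isSymm (S.fR_isSymm ih)
    simp only [LinSys.riccati]
    generalize pinv (S.Bᵀ * (S.riccati Q q 1 k).1 * S.B + 1) = X at *
    generalize (S.riccati Q q 1 k).1 = Pn at *
    simp [Matrix.IsSymm, Matrix.transpose_mul, ih.eq, hQ.eq, hX.eq, Matrix.mul_assoc]

/-! ### The stage form and completion of squares -/

/-- The quadratic form of `H t` at the vector `(u, x, 1)`. -/
def LinSys.stageForm (S : LinSys n m) (z : Candidate n) (t : ℕ) (u : Fin m → ℝ)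
    (x : Fin n → ℝ) : ℝ :=
  u ⬝ᵥ S.fR 1 (z.P (t + 1)) *ᵥ u + 2 * (u ⬝ᵥ S.fS (z.P (t + 1)) *ᵥ x)
    + 2 * (u ⬝ᵥ S.g (z.P (t + 1)) (z.η (t + 1)))
    + x ⬝ᵥ (S.Aᵀ * z.P (t + 1) * S.A + z.Q - z.P t) *ᵥ x + 2 * (S.β z t ⬝ᵥ x) + z.ξ t

/-- The vector `(u, x, s)`. -/
abbrev tripleVec (u : Fin m → ℝ) (x : Fin n → ℝ) (s : ℝ) : Fin m ⊕ (Fin n ⊕ Unit) → ℝ :=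
  Sum.elim u (Sum.elim x fun _ => s)

theorem LinSys.H_mulVec (S : LinSys n m) (z : Candidate n) (t : ℕ) (u : Fin m → ℝ)
    (x : Fin n → ℝ) (s : ℝ) :
    S.H 1 z t *ᵥ tripleVec u x s =
      tripleVec
        (S.fR 1 (z.P (t + 1)) *ᵥ u + S.fS (z.P (t + 1)) *ᵥ x
          + s • S.g (z.P (t + 1)) (z.η (t + 1)))
        ((S.fS (z.P (t + 1)))ᵀ *ᵥ u + (S.Aᵀ * z.P (t + 1) * S.A + z.Q - z.P t) *ᵥ x
          + s • S.β z t)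
        (S.g (z.P (t + 1)) (z.η (t + 1)) ⬝ᵥ u + S.β z t ⬝ᵥ x + s * z.ξ t) := by
  funext i
  rcases i with i | i | i <;>
    simp [LinSys.H, Matrix.mulVec, dotProduct, Fintype.sum_sum_type, mul_comm s, add_assoc]

/-- The last coordinate `s` is kept free because semidefiniteness of `H t` must be tested on all
vectors, while trajectories only see `s = 1`. -/
theorem LinSys.H_quadForm (S : LinSys n m) (z : Candidate n) (t : ℕ) (u : Fin m → ℝ)
    (x : Fin n → ℝ) (s : ℝ) :
    tripleVec u x s ⬝ᵥ S.H 1 z t *ᵥ tripleVec u x s =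
      u ⬝ᵥ S.fR 1 (z.P (t + 1)) *ᵥ u + 2 * (u ⬝ᵥ S.fS (z.P (t + 1)) *ᵥ x)
      + 2 * (s * (u ⬝ᵥ S.g (z.P (t + 1)) (z.η (t + 1))))
      + x ⬝ᵥ (S.Aᵀ * z.P (t + 1) * S.A + z.Q - z.P t) *ᵥ x
      + 2 * (s * (S.β z t ⬝ᵥ x)) + s ^ 2 * z.ξ t := by
  have h3 : ∀ a b : ℝ, ((fun _ : Unit => a) ⬝ᵥ fun _ => b) = a * b := by
    intro a b; simp [dotProduct]
  rw [S.H_mulVec, tripleVec, tripleVec, sumElim_dotProduct_sumElim, sumElim_dotProduct_sumElim,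
    h3]
  simp only [dotProduct_add, dotProduct_smul, smul_eq_mul, dotProduct_transpose_mulVec]
  rw [dotProduct_comm (S.fS _ *ᵥ x) u, dotProduct_comm x (S.β z t), dotProduct_comm _ u]
  ring

theorem LinSys.stageForm_eq (S : LinSys n m) (z : Candidate n) (t : ℕ) (u : Fin m → ℝ)
    (x : Fin n → ℝ) :
    S.stageForm z t u x = tripleVec u x 1 ⬝ᵥ S.H 1 z t *ᵥ tripleVec u x 1 := by
  rw [S.H_quadForm, LinSys.stageForm]; ring

theorem LinSys.stageForm_nonneg (S : LinSys n m) {z : Candidate n} {t : ℕ}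
    (h : (S.H 1 z t).PosSemidef) (u : Fin m → ℝ) (x : Fin n → ℝ) : 0 ≤ S.stageForm z t u x := by
  rw [S.stageForm_eq]
  simpa using h.dotProduct_mulVec_nonneg (tripleVec u x 1)

/-- If the form of a positive semidefinite `H t` vanishes at `(u, x, 1)`, so does `H t`. -/
theorem LinSys.stageForm_eq_zero (S : LinSys n m) {z : Candidate n} {t : ℕ}
    (h : (S.H 1 z t).PosSemidef) {u : Fin m → ℝ} {x : Fin n → ℝ} (h0 : S.stageForm z t u x = 0) :
    S.fR 1 (z.P (t + 1)) *ᵥ u + S.fS (z.P (t + 1)) *ᵥ x + S.g (z.P (t + 1)) (z.η (t + 1)) = 0 ∧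
    (S.fS (z.P (t + 1)))ᵀ *ᵥ u + (S.Aᵀ * z.P (t + 1) * S.A + z.Q - z.P t) *ᵥ x + S.β z t = 0 ∧
    S.g (z.P (t + 1)) (z.η (t + 1)) ⬝ᵥ u + S.β z t ⬝ᵥ x + z.ξ t = 0 := by
  rw [S.stageForm_eq] at h0
  have h1 : S.H 1 z t *ᵥ tripleVec u x 1 = 0 :=
    (h.dotProduct_mulVec_zero_iff _).1 (by simpa using h0)
  rw [S.H_mulVec] at h1
  refine ⟨?_, ?_, ?_⟩
  · funext i; simpa using congrFun h1 (Sum.inl i)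
  · funext i; simpa using congrFun h1 (Sum.inr (Sum.inl i))
  · simpa using congrFun h1 (Sum.inr (Sum.inr ()))

/-- The value function `xᵀ P x / 2 + ηᵀ x`. -/
noncomputable def quadFun (Pm : Matrix (Fin n) (Fin n) ℝ) (e : Fin n → ℝ) (x : Fin n → ℝ) : ℝ :=
  (1 / 2) * (x ⬝ᵥ Pm *ᵥ x) + e ⬝ᵥ x

/-- Completing the square along one step of the noise-free dynamics. -/
theorem LinSys.quadFun_step (S : LinSys n m) (z : Candidate n) (t : ℕ)
    (hP : (z.P (t + 1)).IsSymm) (u : Fin m → ℝ) (x : Fin n → ℝ) :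
    quadFun (z.P (t + 1)) (z.η (t + 1)) (S.A *ᵥ x + S.B *ᵥ u + S.d) =
      (1 / 2) * S.stageForm z t u x - (quadFun z.Q z.q x + (1 / 2) * (u ⬝ᵥ u))
      + quadFun (z.P t) (z.η t) x - (1 / 2) * z.ξ t
      + (1 / 2) * (z.P (t + 1) * Matrix.vecMulVec S.d S.d).trace + z.η (t + 1) ⬝ᵥ S.d := by
  have htr : (z.P (t + 1) * Matrix.vecMulVec S.d S.d).trace = S.d ⬝ᵥ z.P (t + 1) *ᵥ S.d := by
    rw [trace_mul_eq_sum hP, dotProduct_mulVec_eq_sum]; simp [vecMulVec_apply]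
  rw [htr]
  simp only [quadFun, LinSys.stageForm, LinSys.fR, LinSys.fS, LinSys.g, LinSys.β, add_mulVec,
    sub_mulVec, ← mulVec_mulVec, mulVec_add, dotProduct_add, add_dotProduct, sub_dotProduct,
    dotProduct_sub, dotProduct_transpose_mulVec, transpose_mulVec_dotProduct, one_mulVec]
  rw [hP.dotProduct_mulVec_comm (S.A *ᵥ x) (S.B *ᵥ u), hP.dotProduct_mulVec_comm S.d (S.A *ᵥ x),
    hP.dotProduct_mulVec_comm S.d (S.B *ᵥ u), dotProduct_comm _ (z.η (t + 1)),
    dotProduct_comm (z.P (t + 1) *ᵥ S.d) (S.A *ᵥ x)]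
  ring

/-- The affine feedback `u = -𝔑† (𝔖 x + g)`. -/
noncomputable def LinSys.feedback (S : LinSys n m) (z : Candidate n) : Policy n m := fun t x =>
  -(pinv (S.fR 1 (z.P (t + 1))) *ᵥ
    (S.fS (z.P (t + 1)) *ᵥ x + S.g (z.P (t + 1)) (z.η (t + 1))))

/-- Symmetry of the iterate turns `Aᵀ P B` into `𝔖ᵀ`, so that the middle block of `H t` becomes `𝔖ᵀ
𝔑† 𝔖`. The bound `t < ν` keeps the truncated subtraction `ν - t` positive. -/
theorem LinSys.truth_P (S : LinSys n m) {Q : Matrix (Fin n) (Fin n) ℝ} (hQ : Q.IsSymm)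
    (q : Fin n → ℝ) {t : ℕ} (ht : t < S.ν) :
    (S.truth Q q).P t = S.Aᵀ * (S.truth Q q).P (t + 1) * S.A + Q
      - (S.fS ((S.truth Q q).P (t + 1)))ᵀ * pinv (S.fR 1 ((S.truth Q q).P (t + 1)))
        * S.fS ((S.truth Q q).P (t + 1)) := by
  have h1 : S.ν - t = (S.ν - (t + 1)) + 1 := by omega
  have hs := S.riccati_isSymm hQ q (S.ν - (t + 1))
  simp only [LinSys.truth, h1, LinSys.riccati, LinSys.fS, LinSys.fR, transpose_mul,
    transpose_transpose, hs.eq, Matrix.mul_assoc]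

/-- The recursion for `η` cancels everything in `β t` except the cross term of the completed square.
-/
theorem LinSys.truth_β (S : LinSys n m) {Q : Matrix (Fin n) (Fin n) ℝ} (hQ : Q.IsSymm)
    (q : Fin n → ℝ) {t : ℕ} (ht : t < S.ν) :
    S.β (S.truth Q q) t = (S.fS ((S.truth Q q).P (t + 1)))ᵀ *ᵥ
      (pinv (S.fR 1 ((S.truth Q q).P (t + 1))) *ᵥ
        S.g ((S.truth Q q).P (t + 1)) ((S.truth Q q).η (t + 1))) := by
  have h1 : S.ν - t = (S.ν - (t + 1)) + 1 := by omega
  have hs := S.riccati_isSymm hQ q (S.ν - (t + 1))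
  have hX := pinv_isSymm (S.fR_isSymm hs)
  simp only [LinSys.β, LinSys.truth, h1, LinSys.riccati, LinSys.fS, LinSys.g]
  simp only [LinSys.fR] at hX ⊢
  generalize pinv (S.Bᵀ * (S.riccati Q q 1 (S.ν - (t + 1))).1 * S.B + 1) = X at *
  generalize S.riccati Q q 1 (S.ν - (t + 1)) = p at *
  simp only [transpose_sub, transpose_mul, transpose_transpose, hs.eq, hX.eq, sub_mulVec,
    mulVec_add, ← mulVec_mulVec]
  abel

/-- For the Riccati iterates, `H t` is the square completed by the optimal feedback. -/
theorem LinSys.truth_quadForm (S : LinSys n m) {Q : Matrix (Fin n) (Fin n) ℝ} (hQ : Q.IsSymm)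
    (q : Fin n → ℝ) {t : ℕ} (ht : t < S.ν)
    (h : (S.fR 1 ((S.truth Q q).P (t + 1))).PosDef) (u : Fin m → ℝ) (x : Fin n → ℝ) (s : ℝ) :
    let z := S.truth Q q
    let r := pinv (S.fR 1 (z.P (t + 1))) *ᵥ
      (S.fS (z.P (t + 1)) *ᵥ x + s • S.g (z.P (t + 1)) (z.η (t + 1)))
    tripleVec u x s ⬝ᵥ S.H 1 z t *ᵥ tripleVec u x s =
      (u + r) ⬝ᵥ S.fR 1 (z.P (t + 1)) *ᵥ (u + r) := by
  intro z r
  have hs : (z.P (t + 1)).IsSymm := S.riccati_isSymm hQ q _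
  have hPt := S.truth_P hQ q ht
  have hβ := S.truth_β hQ q ht
  have hξ : z.ξ t = S.g (z.P (t + 1)) (z.η (t + 1)) ⬝ᵥ pinv (S.fR 1 (z.P (t + 1))) *ᵥ
    S.g (z.P (t + 1)) (z.η (t + 1)) := rfl
  have hM : S.Aᵀ * z.P (t + 1) * S.A + z.Q - z.P t = (S.fS (z.P (t + 1)))ᵀ *
      pinv (S.fR 1 (z.P (t + 1))) * S.fS (z.P (t + 1)) := by
    change _ + Q - _ = _
    rw [hPt]; abel
  have hR := S.fR_isSymm hs
  have hX := pinv_isSymm hR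
  have hRX := mul_pinv_of_posDef h
  -- Definiteness enters only here: `𝔑 𝔑† = 1`, so `r` solves the stationarity equation exactly.
  have hRr : S.fR 1 (z.P (t + 1)) *ᵥ r =
      S.fS (z.P (t + 1)) *ᵥ x + s • S.g (z.P (t + 1)) (z.η (t + 1)) := by
    rw [mulVec_mulVec, hRX, one_mulVec]
  rw [S.H_quadForm, hM, hξ, show S.β z t = _ from hβ, mulVec_add _ u r, hRr]
  simp only [dotProduct_add, add_dotProduct]
  rw [hR.dotProduct_mulVec_comm r u, hRr]
  simp only [r]
  generalize pinv (S.fR 1 (z.P (t + 1))) = X at *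
  change _ + _ + _ + _ + 2 * (s * ((S.fS (z.P (t + 1)))ᵀ *ᵥ
      (X *ᵥ S.g (z.P (t + 1)) (z.η (t + 1))) ⬝ᵥ x)) + _ = _
  generalize S.g (z.P (t + 1)) (z.η (t + 1)) = g at *
  simp only [← mulVec_mulVec, dotProduct_transpose_mulVec, transpose_mulVec_dotProduct,
    dotProduct_add, add_dotProduct, mulVec_add, mulVec_smul, dotProduct_smul, smul_dotProduct,
    smul_eq_mul]
  generalize S.fS (z.P (t + 1)) *ᵥ x = y at *
  rw [dotProduct_comm (X *ᵥ g) y, dotProduct_comm (X *ᵥ y) g, hX.dotProduct_mulVec_comm g y,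
    dotProduct_comm (X *ᵥ y) y, dotProduct_comm (X *ᵥ g) g]
  ring

theorem LinSys.truth_stageForm (S : LinSys n m) {Q : Matrix (Fin n) (Fin n) ℝ} (hQ : Q.IsSymm)
    (q : Fin n → ℝ) {t : ℕ} (ht : t < S.ν)
    (h : (S.fR 1 ((S.truth Q q).P (t + 1))).PosDef) (u : Fin m → ℝ) (x : Fin n → ℝ) :
    S.stageForm (S.truth Q q) t u x =
      (u - S.feedback (S.truth Q q) t x) ⬝ᵥ S.fR 1 ((S.truth Q q).P (t + 1)) *ᵥ
        (u - S.feedback (S.truth Q q) t x) := by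
  rw [S.stageForm_eq, S.truth_quadForm hQ q ht h]
  simp only [one_smul, LinSys.feedback, sub_neg_eq_add]

/-- `H t` is the pull-back of `𝔑` under the linear map `(u, x, s) ↦ u + 𝔑†(𝔖x + s g)` and inherits
its sign. -/
theorem LinSys.truth_H_posSemidef (S : LinSys n m) {Q : Matrix (Fin n) (Fin n) ℝ}
    (hQ : Q.IsSymm) (q : Fin n → ℝ) {t : ℕ} (ht : t < S.ν)
    (h : (S.fR 1 ((S.truth Q q).P (t + 1))).PosDef) : (S.H 1 (S.truth Q q) t).PosSemidef := by
  have hs : ((S.truth Q q).P (t + 1)).IsSymm := S.riccati_isSymm hQ q _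
  have hs' : ((S.truth Q q).P t).IsSymm := S.riccati_isSymm hQ q _
  refine Matrix.PosSemidef.of_dotProduct_mulVec_nonneg ?_ ?_
  · rw [Matrix.IsHermitian, conjTranspose_eq_transpose_of_trivial]
    have hQ' : ((S.truth Q q).Q).IsSymm := hQ
    have e1 := (S.fR_isSymm hs).eq
    have e2 : (S.Aᵀ * (S.truth Q q).P (t + 1) * S.A + (S.truth Q q).Q - (S.truth Q q).P t)ᵀ
        = S.Aᵀ * (S.truth Q q).P (t + 1) * S.A + (S.truth Q q).Q - (S.truth Q q).P t := by
      simp [transpose_mul, hs.eq, hs'.eq, hQ'.eq, Matrix.mul_assoc]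
    rw [LinSys.H, fromBlocks_transpose, fromBlocks_transpose, e1, e2, transpose_fromCols,
      transpose_fromRows, transpose_transpose]
    rfl
  · intro V
    have hV : V = tripleVec (fun i => V (Sum.inl i)) (fun i => V (Sum.inr (Sum.inl i)))
        (V (Sum.inr (Sum.inr ()))) := by
      funext i; rcases i with i | i | i <;> rfl
    rw [star_trivial, hV, S.truth_quadForm hQ q ht h]
    have := fun y => h.posSemidef.dotProduct_mulVec_nonneg y
    simp only [star_trivial] at this
    exact this _

/-! ### Definiteness, controllability and uniqueness of the kernel equations -/

/-- A positive semidefinite `𝔑` whose kernel is orthogonal to the range of `𝔖` is positive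
definite, because `A` is invertible. -/
theorem LinSys.fR_posDef (S : LinSys n m) (hA : IsUnit S.A) {Pn : Matrix (Fin n) (Fin n) ℝ}
    (hP : Pn.IsSymm) (h0 : ∀ c, 0 ≤ c ⬝ᵥ S.fR 1 Pn *ᵥ c)
    (h1 : ∀ c, S.fR 1 Pn *ᵥ c = 0 → ∀ x, c ⬝ᵥ S.fS Pn *ᵥ x = 0) : (S.fR 1 Pn).PosDef := by
  have hH : (S.fR 1 Pn).IsHermitian := by
    rw [Matrix.IsHermitian, conjTranspose_eq_transpose_of_trivial]; exact S.fR_isSymm hP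
  have hps : (S.fR 1 Pn).PosSemidef := Matrix.PosSemidef.of_dotProduct_mulVec_nonneg hH
    (by simpa using h0)
  refine Matrix.PosDef.of_dotProduct_mulVec_pos hH fun c hc => ?_
  refine lt_of_le_of_ne (by simpa using h0 c) fun he => hc ?_
  have hk : S.fR 1 Pn *ᵥ c = 0 := (hps.dotProduct_mulVec_zero_iff c).1 he.symm
  have hS : S.Aᵀ *ᵥ (Pn *ᵥ (S.B *ᵥ c)) = 0 := by
    have h2 : S.Aᵀ *ᵥ (Pn *ᵥ (S.B *ᵥ c)) = (S.fS Pn)ᵀ *ᵥ c := by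
      simp [LinSys.fS, transpose_mul, hP.eq, Matrix.mul_assoc]
    -- Testing `h1` at `x = 𝔖ᵀ c` turns the pairing into the squared length of `𝔖ᵀ c`.
    rw [h2, ← dotProduct_self_eq_zero, transpose_mulVec_dotProduct]
    exact h1 c hk _
  have hAt : IsUnit S.Aᵀ := by simpa [Matrix.isUnit_iff_isUnit_det] using hA
  have hPB : Pn *ᵥ (S.B *ᵥ c) = 0 := by
    apply Matrix.mulVec_injective_of_isUnit hAt
    simpa using hS
  -- Since `Pn B c = 0`, only the identity in `𝔑` survives: `𝔑 c = c`.
  simpa [LinSys.fR, add_mulVec, ← mulVec_mulVec, hPB] using hk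

theorem eq_zero_of_affine_eq_zero {k l : ℕ} {M : Matrix (Fin l) (Fin k) ℝ} {c : Fin l → ℝ}
    (h : ∀ x, M *ᵥ x + c = 0) : M = 0 ∧ c = 0 := by
  have hc : c = 0 := by simpa using h 0
  refine ⟨?_, hc⟩
  ext i j
  have := congrFun (h (Pi.single j 1)) i
  simpa [hc] using this

/-- A vector orthogonal to all columns of `[B, AB, …]` lies in the kernel of the transposed
controllability matrix, which is trivial by rank and nullity. -/
theorem LinSys.eq_zero_of_controllable (S : LinSys n m) (hctrl : S.IsControllable)
    {x : Fin n → ℝ} (h : ∀ k < n, S.Bᵀ *ᵥ ((S.Aᵀ ^ k) *ᵥ x) = 0) : x = 0 := by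
  rw [LinSys.IsControllable, ← Matrix.rank_transpose] at hctrl
  set C : Matrix (Fin n) (Fin n × Fin m) ℝ :=
    Matrix.of fun (i : Fin n) (c : Fin n × Fin m) => (S.A ^ (c.1 : ℕ) * S.B) i c.2
  have hk := LinearMap.finrank_range_add_finrank_ker (Cᵀ).mulVecLin
  rw [← Matrix.rank, hctrl, Module.finrank_fin_fun] at hk
  have hk0 : LinearMap.ker (Cᵀ).mulVecLin = ⊥ := Submodule.finrank_eq_zero.1 (by omega)
  refine LinearMap.ker_eq_bot.1 hk0 ?_
  rw [map_zero]
  funext c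
  have := congrFun (h c.1 c.1.2) c.2
  rw [← Matrix.transpose_pow, mulVec_mulVec, ← transpose_mul] at this
  exact this

/-- The recursion for the difference of two Riccati sequences with the same gains has only the
zero solution. -/
theorem LinSys.eq_zero_of_recursion (S : LinSys n m) (hctrl : S.IsControllable)
    {κ : Type*} [Fintype κ] [DecidableEq κ] {l : ℕ} (hl : n ≤ l)
    (D : ℕ → Matrix (Fin n) κ ℝ) (T : Matrix κ κ ℝ) (hT : IsUnit T)
    (hrec : ∀ k < l, D (k + 1) = S.Aᵀ * D k * T + D 0) (hB : ∀ k < l, S.Bᵀ * D k = 0) :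
    ∀ k ≤ l, D k = 0 := by
  -- Differencing removes the constant term `D 0`. The right factor `T` will be `A` for the
  -- differences of `P` and `1` for those of `η`.
  have hdiff : ∀ k, k + 1 < l → D (k + 1) - D k = S.Aᵀ ^ (k + 1) * D 0 * T ^ (k + 1) := by
    intro k
    induction k with
    | zero => intro hk; rw [hrec 0 (by omega)]; simp
    | succ k ih =>
      intro hk
      have := ih (by omega)
      rw [hrec (k + 1) (by omega)]
      nth_rewrite 2 [hrec k (by omega)]
      rw [add_sub_add_right_eq_sub, ← Matrix.sub_mul, ← Matrix.mul_sub, this, pow_succ' S.Aᵀ (k + 1),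
        pow_succ T (k + 1)]
      simp only [Matrix.mul_assoc]
  -- `Bᵀ` kills consecutive differences, and the invertible factor `T ^ k` cancels; `n ≤ l` then
  -- supplies all the powers that controllability needs.
  have hkey : ∀ k < l, S.Bᵀ * (S.Aᵀ ^ k * D 0) = 0 := by
    intro k hk
    have hz : S.Bᵀ * (S.Aᵀ ^ k * D 0 * T ^ k) = 0 := by
      cases k with
      | zero => simpa using hB 0 hk
      | succ k =>
        rw [← hdiff k hk, Matrix.mul_sub, hB _ hk, hB k (by omega), sub_zero]
    have hTk := hT.pow k
    rw [← Matrix.mul_assoc] at hz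
    obtain ⟨U, hU⟩ := hTk
    have := congrArg (· * (↑U⁻¹ : Matrix κ κ ℝ)) hz
    simpa [Matrix.mul_assoc, ← hU] using this
  have hD0 : D 0 = 0 := by
    ext i j
    have : (fun i => D 0 i j) = 0 := by
      refine S.eq_zero_of_controllable hctrl fun k hk => ?_
      funext b
      have := congrFun (congrFun (hkey k (by omega)) b) j
      rw [mulVec_mulVec]
      rw [← Matrix.mul_assoc] at this
      simpa [Matrix.mul_apply, Matrix.mulVec, dotProduct] using this
    exact congrFun this i
  intro k hk
  induction k with
  | zero => exact hD0
  | succ k ih => rw [hrec k (by omega), ih (by omega), hD0]; simp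

/-- The kernel equations `H t (u, x, 1) = 0`. -/
structure LinSys.Tight (S : LinSys n m) (z : Candidate n) (t : ℕ) (u : Fin m → ℝ)
    (x : Fin n → ℝ) : Prop where
  row_u : S.fR 1 (z.P (t + 1)) *ᵥ u + S.fS (z.P (t + 1)) *ᵥ x
    + S.g (z.P (t + 1)) (z.η (t + 1)) = 0
  row_x : (S.fS (z.P (t + 1)))ᵀ *ᵥ u + (S.Aᵀ * z.P (t + 1) * S.A + z.Q - z.P t) *ᵥ x
    + S.β z t = 0
  row_one : S.g (z.P (t + 1)) (z.η (t + 1)) ⬝ᵥ u + S.β z t ⬝ᵥ x + z.ξ t = 0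

/-- The stationarity condition in terms of the successor state. -/
theorem LinSys.Tight.control_eq {S : LinSys n m} {z : Candidate n} {t : ℕ} {u : Fin m → ℝ}
    {x : Fin n → ℝ} (h : S.Tight z t u x) :
    S.Bᵀ *ᵥ (z.P (t + 1) *ᵥ (S.A *ᵥ x + S.B *ᵥ u + S.d) + z.η (t + 1)) = -u := by
  have := h.row_u
  simp only [LinSys.fR, LinSys.fS, LinSys.g, add_mulVec, one_mulVec, ← mulVec_mulVec] at this
  rw [← sub_eq_zero, sub_neg_eq_add, ← this]
  simp only [mulVec_add]
  abel

/-- The costate equation. -/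
theorem LinSys.Tight.costate_eq {S : LinSys n m} {z : Candidate n} {t : ℕ} {u : Fin m → ℝ}
    {x : Fin n → ℝ} (hP : (z.P (t + 1)).IsSymm) (h : S.Tight z t u x) :
    z.P t *ᵥ x + z.η t = z.Q *ᵥ x + z.q
      + S.Aᵀ *ᵥ (z.P (t + 1) *ᵥ (S.A *ᵥ x + S.B *ᵥ u + S.d) + z.η (t + 1)) := by
  have := h.row_x
  simp only [LinSys.fS, LinSys.β, transpose_mul, transpose_transpose, hP.eq, sub_mulVec,
    add_mulVec, ← mulVec_mulVec] at this
  rw [← sub_eq_zero, ← neg_eq_zero, ← this]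
  simp only [mulVec_add]
  abel

/-- The closed-loop matrix is invertible when the gain is stationary. -/
theorem LinSys.isUnit_closedLoop (S : LinSys n m) (hA : IsUnit S.A)
    {Pn : Matrix (Fin n) (Fin n) ℝ} {K : Matrix (Fin m) (Fin n) ℝ}
    (hK : S.fR 1 Pn * K + S.fS Pn = 0) : IsUnit (S.A + S.B * K) := by
  rw [← Matrix.mulVec_injective_iff_isUnit]
  refine (injective_iff_map_eq_zero (S.A + S.B * K).mulVecLin).2 fun x hx => ?_
  rw [Matrix.mulVecLin_apply] at hx
  have h1 : K *ᵥ x = 0 := by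
    -- Stationarity expresses the gain through the closed-loop matrix, so a vector in the kernel of
    -- `A + BK` is in the kernel of `K`, hence of `A`.
    have h2 : K = -(S.Bᵀ * Pn * (S.A + S.B * K)) := by
      rw [eq_neg_iff_add_eq_zero, ← hK]
      simp only [LinSys.fR, LinSys.fS, Matrix.mul_add, Matrix.add_mul, Matrix.one_mul,
        Matrix.mul_assoc]
      abel
    rw [h2, neg_mulVec, ← mulVec_mulVec, hx, mulVec_zero, neg_zero]
  rw [add_mulVec, ← mulVec_mulVec, h1, mulVec_zero, add_zero] at hx
  exact (Matrix.mulVec_injective_of_isUnit hA) (by simpa using hx)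

/-- Two candidates whose matrices `H t` vanish along the same affine feedback coincide. -/
theorem LinSys.same_of_tight (S : LinSys n m) (hctrl : S.IsControllable) (hA : IsUnit S.A)
    (hν : n + 1 ≤ S.ν) {z z' : Candidate n}
    (hs : ∀ t ∈ Finset.Icc 1 S.ν, (z.P t).IsSymm)
    (hs' : ∀ t ∈ Finset.Icc 1 S.ν, (z'.P t).IsSymm)
    (hP : z.P S.ν = z.Q) (hη : z.η S.ν = z.q) (hP' : z'.P S.ν = z'.Q) (hη' : z'.η S.ν = z'.q)
    (K : ℕ → Matrix (Fin m) (Fin n) ℝ) (k : ℕ → Fin m → ℝ)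
    (hu : ∀ t ∈ Finset.Icc 1 (S.ν - 1), IsUnit (S.A + S.B * K t))
    (h : ∀ t ∈ Finset.Icc 1 (S.ν - 1), ∀ x, S.Tight z t (K t *ᵥ x + k t) x)
    (h' : ∀ t ∈ Finset.Icc 1 (S.ν - 1), ∀ x, S.Tight z' t (K t *ᵥ x + k t) x) :
    z.Same S.ν z' := by
  have hB : ∀ t ∈ Finset.Icc 1 (S.ν - 1), S.Bᵀ * (z.P (t + 1) - z'.P (t + 1)) = 0 ∧
      S.Bᵀ *ᵥ (z.η (t + 1) - z'.η (t + 1)) = 0 := by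
    intro t ht
    -- Every `y` is the noise-free successor of some `x`, because `A + BK` is onto. Both candidates
    -- give the same `-u` there, so an affine function of `y` vanishes identically.
    refine eq_zero_of_affine_eq_zero fun y => ?_
    obtain ⟨x, hx⟩ : ∃ x, (S.A + S.B * K t) *ᵥ x = y - S.d - S.B *ᵥ k t :=
      (Matrix.mulVec_surjective_iff_isUnit.2 (hu t ht)) _
    have hy : S.A *ᵥ x + S.B *ᵥ (K t *ᵥ x + k t) + S.d = y := by
      rw [mulVec_add, mulVec_mulVec, ← add_assoc, ← add_mulVec, hx]; abel
    have e := (h t ht x).control_eq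
    have e' := (h' t ht x).control_eq
    rw [hy] at e e'
    have := e.trans e'.symm
    rw [← sub_eq_zero, ← mulVec_sub] at this
    rw [← mulVec_mulVec, ← mulVec_add, ← this, sub_mulVec]
    congr 1
    abel
  have hrec : ∀ t ∈ Finset.Icc 1 (S.ν - 1),
      z.P t - z'.P t = S.Aᵀ * (z.P (t + 1) - z'.P (t + 1)) * S.A + (z.Q - z'.Q) ∧
      z.η t - z'.η t = S.Aᵀ *ᵥ ((z.P (t + 1) - z'.P (t + 1)) *ᵥ S.d
        + (z.η (t + 1) - z'.η (t + 1))) + (z.q - z'.q) := by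
    intro t ht
    have ht1 : t + 1 ∈ Finset.Icc 1 S.ν := by simp only [Finset.mem_Icc] at *; omega
    -- With this the control drops out of the difference of the costate equations, and the recursion
    -- no longer contains the gain.
    have hPB : (z.P (t + 1) - z'.P (t + 1)) * S.B = 0 := by
      have := congrArg transpose (hB t ht).1
      simpa [transpose_mul, (hs _ ht1).eq, (hs' _ ht1).eq] using this
    have := eq_zero_of_affine_eq_zero (M := z.P t - z'.P t
        - (S.Aᵀ * (z.P (t + 1) - z'.P (t + 1)) * S.A + (z.Q - z'.Q)))
      (c := z.η t - z'.η t - (S.Aᵀ *ᵥ ((z.P (t + 1) - z'.P (t + 1)) *ᵥ S.d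
        + (z.η (t + 1) - z'.η (t + 1))) + (z.q - z'.q))) fun x => by
      have e := (h t ht x).costate_eq (hs _ ht1)
      have e' := (h' t ht x).costate_eq (hs' _ ht1)
      have hu0 : (z.P (t + 1) - z'.P (t + 1)) *ᵥ (S.B *ᵥ (K t *ᵥ x + k t)) = 0 := by
        rw [mulVec_mulVec, hPB, zero_mulVec]
      generalize K t *ᵥ x + k t = u at *
      have e2 := congrArg₂ (· - ·) e e'
      have e3 := congrArg (S.Aᵀ *ᵥ ·) hu0
      simp only [sub_mulVec, mulVec_sub, mulVec_add, add_mulVec, ← mulVec_mulVec,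
        mulVec_zero] at *
      rw [← sub_eq_zero] at e2
      rw [← e2, ← sub_eq_zero, ← e3]
      abel
    exact ⟨sub_eq_zero.1 this.1, sub_eq_zero.1 this.2⟩
  have hidx : ∀ k < S.ν - 1, S.ν - (k + 1) + 1 = S.ν - k ∧
      S.ν - (k + 1) ∈ Finset.Icc 1 (S.ν - 1) := by
    intro k hk; simp only [Finset.mem_Icc]; omega
  -- Time is reversed, `k ↦ ν - k`; the boundary condition `P ν = Q` makes the constant term the
  -- initial value.
  have hDP := S.eq_zero_of_recursion hctrl (l := S.ν - 1) (by omega)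
    (fun k => z.P (S.ν - k) - z'.P (S.ν - k)) S.A hA
    (fun k hk => by
      have := (hrec _ (hidx k hk).2).1
      rw [(hidx k hk).1] at this
      simpa [hP, hP'] using this)
    (fun k hk => by
      have := (hB _ (hidx k hk).2).1
      rwa [(hidx k hk).1] at this)
  have hPeq : ∀ t ∈ Finset.Icc 1 S.ν, z.P t = z'.P t := by
    intro t ht
    rw [Finset.mem_Icc] at ht
    have := hDP (S.ν - t) (by omega)
    rw [show S.ν - (S.ν - t) = t by omega] at this
    exact sub_eq_zero.1 this
  have hDη := S.eq_zero_of_recursion hctrl (l := S.ν - 1) (by omega)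
    (fun k => replicateCol Unit (z.η (S.ν - k) - z'.η (S.ν - k))) 1 isUnit_one
    (fun k hk => by
      have := (hrec _ (hidx k hk).2).2
      rw [(hidx k hk).1, hPeq (S.ν - k) (by simp only [Finset.mem_Icc]; omega), sub_self,
        zero_mulVec, zero_add] at this
      simp only [this, hη, hη', Nat.sub_zero, Matrix.mul_one, replicateCol_add,
        replicateCol_mulVec])
    (fun k hk => by
      have := (hB _ (hidx k hk).2).2
      rw [(hidx k hk).1] at this
      rw [← replicateCol_mulVec, this]; rfl)
  have hηeq : ∀ t ∈ Finset.Icc 1 S.ν, z.η t = z'.η t := by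
    intro t ht
    rw [Finset.mem_Icc] at ht
    have := hDη (S.ν - t) (by omega)
    rw [show S.ν - (S.ν - t) = t by omega] at this
    funext i
    exact sub_eq_zero.1 (congrFun (congrFun this i) ())
  have hQ : z.Q = z'.Q := by
    rcases Nat.eq_zero_or_pos S.ν with h0 | h0
    · omega
    · rw [← hP, ← hP']; exact hPeq _ (by simp only [Finset.mem_Icc]; omega)
  have hq : z.q = z'.q := by
    rw [← hη, ← hη']; exact hηeq _ (by simp only [Finset.mem_Icc]; omega)
  refine ⟨hQ, hq, hPeq, hηeq, fun t ht => ?_⟩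
  -- At `x = 0` the last kernel equation reads `ξ t = -g · k t`, and `g` is already common.
  have e := (h t ht 0).row_one
  have e' := (h' t ht 0).row_one
  have ht1 : t + 1 ∈ Finset.Icc 1 S.ν := by simp only [Finset.mem_Icc] at *; omega
  rw [hPeq _ ht1, hηeq _ ht1, dotProduct_zero] at e
  rw [dotProduct_zero] at e'
  linarith

/-! ### Trajectories -/

/-- The move made at time `ν - N` is still a rest, so the state stays at `x₁` one time step longer
than the control stays zero. -/
theorem LinSys.state_initial (S : LinSys n m) (N : ℕ) (x₁ : Fin n → ℝ) (μ : Policy n m)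
    (w : ℕ → Fin n → ℝ) {t : ℕ} (ht : t ≤ S.ν - N + 1) : S.state N x₁ μ w t = x₁ := by
  induction t with
  | zero => rfl
  | succ t ih => rw [LinSys.state, if_pos (by omega), ih (by omega)]

theorem LinSys.control_initial (S : LinSys n m) (N : ℕ) (x₁ : Fin n → ℝ) (μ : Policy n m)
    (w : ℕ → Fin n → ℝ) {t : ℕ} (ht : t ≤ S.ν - N) : S.control N x₁ μ w t = 0 := if_pos ht

theorem LinSys.control_active (S : LinSys n m) (N : ℕ) (x₁ : Fin n → ℝ) (μ : Policy n m)
    (w : ℕ → Fin n → ℝ) {t : ℕ} (ht : S.ν - N + 1 ≤ t) :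
    S.control N x₁ μ w t = μ t (S.state N x₁ μ w t) := if_neg (by omega)

theorem LinSys.state_succ (S : LinSys n m) (N : ℕ) (x₁ : Fin n → ℝ) (μ : Policy n m)
    (w : ℕ → Fin n → ℝ) {t : ℕ} (ht : S.ν - N + 1 ≤ t) :
    S.state N x₁ μ w (t + 1) =
      S.A *ᵥ S.state N x₁ μ w t + S.B *ᵥ S.control N x₁ μ w t + S.d + w t := by
  rw [S.control_active _ _ _ _ ht, LinSys.state, if_neg (by omega)]

/-- The state at time `t` depends on the noise at the times `1, …, t - 1` only. -/
theorem LinSys.state_congr (S : LinSys n m) (N : ℕ) (x₁ : Fin n → ℝ) (μ : Policy n m)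
    {w w' : ℕ → Fin n → ℝ} {t : ℕ} (h : ∀ s, 1 ≤ s → s < t → w s = w' s) :
    S.state N x₁ μ w t = S.state N x₁ μ w' t := by
  induction t with
  | zero => rfl
  | succ t ih =>
    have ih := ih fun s h1 h2 => h s h1 (by omega)
    by_cases ht : t ≤ S.ν - N
    · rw [LinSys.state, LinSys.state, if_pos ht, if_pos ht, ih]
    · rw [LinSys.state, LinSys.state, if_neg ht, if_neg ht, ih, h t (by omega) (by omega)]

theorem measurable_mulVec {k l : ℕ} (M : Matrix (Fin l) (Fin k) ℝ) :
    Measurable fun x : Fin k → ℝ => M *ᵥ x :=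
  (M.mulVecLin.continuous_of_finiteDimensional).measurable

/-- Trajectories are measurable in the initial state and the noise, also when the strategy
depends measurably on a parameter. -/
theorem LinSys.measurable_state (S : LinSys n m) {E : Type*} [MeasurableSpace E] (N : ℕ)
    (μ : E → Policy n m) (x : E → Fin n → ℝ) (w : E → ℕ → Fin n → ℝ)
    (hμ : ∀ t ∈ Finset.Icc (S.ν - N + 1) (S.ν - 1),
      Measurable fun p : E × (Fin n → ℝ) => μ p.1 t p.2)
    (hx : Measurable x) {t : ℕ} (hw : ∀ s, 1 ≤ s → s < t → Measurable fun e => w e s)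
    (ht : t ≤ S.ν) : Measurable fun e => S.state N (x e) (μ e) (w e) t := by
  induction t with
  | zero => exact hx
  | succ t ih =>
    have ih := ih (fun s h1 h2 => hw s h1 (by omega)) (by omega)
    by_cases hc : t ≤ S.ν - N
    · simpa only [LinSys.state, if_pos hc] using ih
    · simp only [LinSys.state, if_neg hc]
      have h1 : Measurable fun e => μ e t (S.state N (x e) (μ e) (w e) t) :=
        (hμ t (by simp only [Finset.mem_Icc]; omega)).comp (measurable_id.prodMk ih)
      exact ((((measurable_mulVec S.A).comp ih).add ((measurable_mulVec S.B).comp h1)).add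
        measurable_const).add (hw t (by omega) (by omega))

theorem LinSys.measurable_control (S : LinSys n m) {E : Type*} [MeasurableSpace E] (N : ℕ)
    (μ : E → Policy n m) (x : E → Fin n → ℝ) (w : E → ℕ → Fin n → ℝ)
    (hμ : ∀ t ∈ Finset.Icc (S.ν - N + 1) (S.ν - 1),
      Measurable fun p : E × (Fin n → ℝ) => μ p.1 t p.2)
    (hx : Measurable x) {t : ℕ} (hw : ∀ s, 1 ≤ s → s < t → Measurable fun e => w e s)
    (ht : t < S.ν) : Measurable fun e => S.control N (x e) (μ e) (w e) t := by
  by_cases hc : t ≤ S.ν - N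
  · simpa only [LinSys.control, if_pos hc] using measurable_const
  · simp only [LinSys.control, if_neg hc]
    exact (hμ t (by simp only [Finset.mem_Icc]; omega)).comp
      (measurable_id.prodMk (S.measurable_state N μ x w hμ hx hw (by omega)))

/-! ### Square integrable random vectors and noise -/

variable {Ω : Type*} [MeasurableSpace Ω] {μ : Measure Ω}

theorem memLp_mulVec {k l : ℕ} (M : Matrix (Fin l) (Fin k) ℝ) {X : Ω → Fin k → ℝ}
    (hX : MemLp X 2 μ) : MemLp (fun ω => M *ᵥ X ω) 2 μ :=
  (LinearMap.toContinuousLinearMap M.mulVecLin).comp_memLp' hX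

theorem integrable_dotProduct {k : ℕ} {X Y : Ω → Fin k → ℝ} (hX : MemLp X 2 μ)
    (hY : MemLp Y 2 μ) : Integrable (fun ω => X ω ⬝ᵥ Y ω) μ :=
  integrable_finsetSum _ fun i _ => (hX.eval i).integrable_mul (hY.eval i)

theorem integrable_quadForm {k l : ℕ} (M : Matrix (Fin k) (Fin l) ℝ) {X : Ω → Fin k → ℝ}
    {Y : Ω → Fin l → ℝ} (hX : MemLp X 2 μ) (hY : MemLp Y 2 μ) :
    Integrable (fun ω => X ω ⬝ᵥ M *ᵥ Y ω) μ :=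
  integrable_dotProduct hX (memLp_mulVec M hY)

theorem integrable_const_dotProduct [IsFiniteMeasure μ] {k : ℕ} (e : Fin k → ℝ)
    {X : Ω → Fin k → ℝ} (hX : MemLp X 2 μ) : Integrable (fun ω => e ⬝ᵥ X ω) μ :=
  integrable_dotProduct (memLp_const e) hX

theorem integrable_quadFun [IsFiniteMeasure μ] (M : Matrix (Fin n) (Fin n) ℝ) (e : Fin n → ℝ)
    {X : Ω → Fin n → ℝ} (hX : MemLp X 2 μ) : Integrable (fun ω => quadFun M e (X ω)) μ :=
  ((integrable_quadForm M hX hX).const_mul _).add (integrable_const_dotProduct e hX)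

theorem LinSys.integrable_stageForm [IsFiniteMeasure μ] (S : LinSys n m) (z : Candidate n)
    (t : ℕ) {U : Ω → Fin m → ℝ} {X : Ω → Fin n → ℝ} (hU : MemLp U 2 μ) (hX : MemLp X 2 μ) :
    Integrable (fun ω => S.stageForm z t (U ω) (X ω)) μ := by
  have h1 := integrable_quadForm (S.fR 1 (z.P (t + 1))) hU hU
  have h2 := integrable_quadForm (S.fS (z.P (t + 1))) hU hX
  have h3 := integrable_dotProduct hU (memLp_const (S.g (z.P (t + 1)) (z.η (t + 1))))
  have h4 := integrable_quadForm (S.Aᵀ * z.P (t + 1) * S.A + z.Q - z.P t) hX hX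
  have h5 := integrable_const_dotProduct (S.β z t) hX
  exact ((((h1.add (h2.const_mul 2)).add (h3.const_mul 2)).add h4).add (h5.const_mul 2)).add
    (integrable_const _)

/-- Adding independent centred noise with covariance `Cov` to a random vector. -/
theorem integral_quadFun_add_noise [IsProbabilityMeasure μ] {M Cov : Matrix (Fin n) (Fin n) ℝ}
    (hM : M.IsSymm) (e : Fin n → ℝ) {X W : Ω → Fin n → ℝ} (hX : MemLp X 2 μ)
    (hW : MemLp W 2 μ) (hmean : ∫ ω, W ω ∂μ = 0)
    (hcov : ∀ i j, covariance (fun ω => W ω i) (fun ω => W ω j) μ = Cov i j)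
    (hind : IndepFun X W μ) :
    ∫ ω, quadFun M e (X ω + W ω) ∂μ =
      ∫ ω, quadFun M e (X ω) ∂μ + (1 / 2) * (M * Cov).trace := by
  have hmi : ∀ i, ∫ ω, W ω i ∂μ = 0 := by
    intro i
    rw [← eval_integral (fun i => (hW.eval i).integrable (by norm_num)), hmean]; rfl
  have hWW : ∫ ω, W ω ⬝ᵥ M *ᵥ W ω ∂μ = (M * Cov).trace := by
    simp_rw [trace_mul_eq_sum hM, dotProduct_mulVec_eq_sum]
    have hint : ∀ i j, Integrable (fun ω => M i j * (W ω i * W ω j)) μ := fun i j =>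
      ((hW.eval i).integrable_mul (hW.eval j)).const_mul _
    rw [integral_finsetSum _ fun i _ => integrable_finsetSum _ fun j _ => hint i j]
    refine Finset.sum_congr rfl fun i _ => ?_
    rw [integral_finsetSum _ fun j _ => hint i j]
    refine Finset.sum_congr rfl fun j _ => ?_
    rw [integral_const_mul, ← hcov i j, covariance_eq_sub (hW.eval i) (hW.eval j), hmi i, hmi j]
    simp
  have hXW : ∫ ω, X ω ⬝ᵥ M *ᵥ W ω ∂μ = 0 := by
    simp_rw [dotProduct_mulVec_eq_sum]
    have hint : ∀ i j, Integrable (fun ω => M i j * (X ω i * W ω j)) μ := fun i j =>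
      ((hX.eval i).integrable_mul (hW.eval j)).const_mul _
    rw [integral_finsetSum _ fun i _ => integrable_finsetSum _ fun j _ => hint i j]
    refine Finset.sum_eq_zero fun i _ => ?_
    rw [integral_finsetSum _ fun j _ => hint i j]
    refine Finset.sum_eq_zero fun j _ => ?_
    have hij : IndepFun (fun ω => X ω i) (fun ω => W ω j) μ :=
      hind.comp (measurable_pi_apply i) (measurable_pi_apply j)
    rw [integral_const_mul, hij.integral_fun_mul_eq_mul_integral
      (hX.eval i).aestronglyMeasurable (hW.eval j).aestronglyMeasurable, hmi j]
    simp
  have heW : ∫ ω, e ⬝ᵥ W ω ∂μ = 0 := by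
    simp only [dotProduct]
    rw [integral_finsetSum _ fun i _ => ((hW.eval i).integrable (by norm_num)).const_mul _]
    exact Finset.sum_eq_zero fun i _ => by rw [integral_const_mul, hmi i, mul_zero]
  have hpt : ∀ ω, quadFun M e (X ω + W ω) = quadFun M e (X ω) + X ω ⬝ᵥ M *ᵥ W ω
      + (1 / 2) * (W ω ⬝ᵥ M *ᵥ W ω) + e ⬝ᵥ W ω := by
    intro ω
    simp only [quadFun, mulVec_add, dotProduct_add, add_dotProduct]
    rw [hM.dotProduct_mulVec_comm (W ω) (X ω)]
    ring
  have i1 := integrable_quadFun M e hX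
  have i2 := integrable_quadForm M hX hW
  have i3 := (integrable_quadForm M hW hW).const_mul (1 / 2)
  have i4 := integrable_const_dotProduct e hW
  have i12 : Integrable (fun ω => quadFun M e (X ω) + X ω ⬝ᵥ M *ᵥ W ω) μ := i1.add i2
  have i123 : Integrable (fun ω => quadFun M e (X ω) + X ω ⬝ᵥ M *ᵥ W ω
      + (1 / 2) * (W ω ⬝ᵥ M *ᵥ W ω)) μ := i12.add i3
  simp_rw [hpt]
  rw [integral_add i123 i4, integral_add i12 i3, integral_add i1 i2,
    integral_const_mul, hWW, hXW, heW]
  ring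

/-! ### Independence and conditioning on the horizon -/

/-- Mutual independence of three variables, rebracketed. -/
theorem indepFun_prodMk_of_indepFun {E F G : Type*} [MeasurableSpace E] [MeasurableSpace F]
    [MeasurableSpace G] [IsProbabilityMeasure μ] {X : Ω → E} {Y : Ω → F} {Z : Ω → G}
    (hX : Measurable X) (hY : Measurable Y) (hZ : Measurable Z)
    (h : IndepFun X (fun ω => (Y ω, Z ω)) μ) (h' : IndepFun Y Z μ) :
    IndepFun (fun ω => (X ω, Y ω)) Z μ := by
  have hXY : IndepFun X Y μ := h.comp measurable_id measurable_fst
  rw [indepFun_iff_map_prod_eq_prod_map_map hX.aemeasurable (hY.prodMk hZ).aemeasurable] at h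
  rw [indepFun_iff_map_prod_eq_prod_map_map hX.aemeasurable hY.aemeasurable] at hXY
  rw [indepFun_iff_map_prod_eq_prod_map_map hY.aemeasurable hZ.aemeasurable] at h'
  rw [indepFun_iff_map_prod_eq_prod_map_map (hX.prodMk hY).aemeasurable hZ.aemeasurable]
  have := Measure.isProbabilityMeasure_map (μ := μ) hX.aemeasurable
  have := Measure.isProbabilityMeasure_map (μ := μ) hY.aemeasurable
  have := Measure.isProbabilityMeasure_map (μ := μ) hZ.aemeasurable
  -- After reassociating, both sides are the product of the three marginal laws.
  apply MeasurableEquiv.prodAssoc.map_measurableEquiv_injective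
  rw [hXY, Measure.prodAssoc_prod, ← h', ← h,
    Measure.map_map MeasurableEquiv.prodAssoc.measurable ((hX.prodMk hY).prodMk hZ)]
  rfl

/-- Conditioning on an event that is independent of `Y` changes neither the law of `Y` nor its
independence of the remaining variables. -/
theorem indepFun_cond {E F : Type*} [MeasurableSpace E] [MeasurableSpace F]
    [IsProbabilityMeasure μ] {X : Ω → E} {N : Ω → ℕ} {Y : Ω → F} (hN : Measurable N)
    (hY : Measurable Y) (h : IndepFun (fun ω => (X ω, N ω)) Y μ) {k : ℕ}
    (hk : 0 < μ {ω | N ω = k}) :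
    IndepFun X Y (condHorizon μ N k) ∧ (condHorizon μ N k).map Y = μ.map Y := by
  have hE : MeasurableSet {ω | N ω = k} := hN (measurableSet_singleton k)
  have h0 : μ {ω | N ω = k} ≠ 0 := hk.ne'
  have ht : μ {ω | N ω = k} ≠ ⊤ := measure_ne_top _ _
  -- The horizon is paired with `X` in the hypothesis, so `{N = k} ∩ X ⁻¹' s` is an event of that
  -- pair and is independent of `Y`.
  have key : ∀ (s : Set E) (t : Set F), MeasurableSet s → MeasurableSet t →
      condHorizon μ N k (X ⁻¹' s ∩ Y ⁻¹' t) = condHorizon μ N k (X ⁻¹' s) * μ (Y ⁻¹' t) := by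
    intro s t hs ht
    have := h.measure_inter_preimage_eq_mul (s ×ˢ {k}) t
      (hs.prod (measurableSet_singleton k)) ht
    have e : (fun ω => (X ω, N ω)) ⁻¹' (s ×ˢ {k}) = {ω | N ω = k} ∩ X ⁻¹' s := by
      ext ω; simp [and_comm]
    rw [e] at this
    rw [condHorizon, cond_apply hE, cond_apply hE, ← Set.inter_assoc, this, mul_assoc]
  have law : ∀ t, MeasurableSet t → condHorizon μ N k (Y ⁻¹' t) = μ (Y ⁻¹' t) := by
    intro t ht'
    have := key Set.univ t MeasurableSet.univ ht'
    have hp : IsProbabilityMeasure (condHorizon μ N k) := cond_isProbabilityMeasure h0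
    simpa using this
  refine ⟨?_, Measure.ext fun t ht' => ?_⟩
  · rw [indepFun_iff_measure_inter_preimage_eq_mul]
    intro s t hs ht'
    rw [key s t hs ht', law t ht']
  · rw [Measure.map_apply hY ht', Measure.map_apply hY ht', law t ht']

theorem IsIIDNoise.measurable_shift {w : ℕ → Ω → Fin n → ℝ} {Cov : Matrix (Fin n) (Fin n) ℝ}
    (hw : IsIIDNoise μ w Cov) : Measurable fun ω (k : ℕ) => w (k + 1) ω :=
  measurable_pi_lambda _ fun k => hw.measurable (k + 1) (by omega)

theorem identDistrib_of_map_eq {E : Type*} [MeasurableSpace E] {μ' : Measure Ω} {Y : Ω → E}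
    (hY : Measurable Y) (h : μ'.map Y = μ.map Y) : IdentDistrib Y Y μ' μ :=
  ⟨hY.aemeasurable, hY.aemeasurable, h⟩

/-- The noise assumptions concern the law of the noise only. -/
theorem IsIIDNoise.of_map_eq [IsProbabilityMeasure μ] {μ' : Measure Ω} [IsProbabilityMeasure μ']
    {w : ℕ → Ω → Fin n → ℝ} {Cov : Matrix (Fin n) (Fin n) ℝ} (hw : IsIIDNoise μ w Cov)
    (h : μ'.map (fun ω (k : ℕ) => w (k + 1) ω) = μ.map (fun ω (k : ℕ) => w (k + 1) ω)) :
    IsIIDNoise μ' w Cov := by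
  have hid := identDistrib_of_map_eq hw.measurable_shift h
  have hidt : ∀ t, 1 ≤ t → IdentDistrib (w t) (w t) μ' μ := by
    intro t ht
    have := hid.comp (measurable_pi_apply (t - 1))
    simp only [Function.comp_def, Nat.sub_add_cancel ht] at this
    exact this
  refine ⟨hw.measurable, ?_, ?_, ?_, ?_, ?_⟩
  · have hm : ∀ k : ℕ, Measurable fun ω => w (k + 1) ω := fun k => hw.measurable _ (by omega)
    -- Independence says that the joint law is the product of its marginals, a property of the joint
    -- law alone.
    rw [iIndepFun_iff_map_fun_eq_infinitePi_map hm, h,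
      (iIndepFun_iff_map_fun_eq_infinitePi_map hm).1 hw.indep]
    congr 1
    funext k
    exact (hidt (k + 1) (by omega)).map_eq.symm
  · exact fun s t hs ht => ((hidt s hs).trans (hw.ident s t hs ht)).trans (hidt t ht).symm
  · exact fun t ht => (hidt t ht).memLp_iff.2 (hw.memLp t ht)
  · intro t ht; rw [(hidt t ht).integral_eq, hw.mean t ht]
  · intro t ht i j
    rw [← hw.cov t ht i j]
    have hm := hw.measurable t ht
    have hmi : ∀ (ρ : Measure (Fin n → ℝ)) (i : Fin n),
      AEStronglyMeasurable (fun x : Fin n → ℝ => x i) ρ :=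
      fun ρ i => (measurable_pi_apply i).aestronglyMeasurable
    have e1 := covariance_map_fun (hmi _ i) (hmi _ j) (μ := μ') hm.aemeasurable
    have e2 := covariance_map_fun (hmi _ i) (hmi _ j) (μ := μ) hm.aemeasurable
    rw [← e1, ← e2, (hidt t ht).map_eq]

/-! ### Closed loops and the telescoping identity -/

/-- The closed loop of a fixed strategy with square integrable initial state and controls, the
initial state being independent of the noise. -/
structure LinSys.ClosedLoop (S : LinSys n m) (μ : Measure Ω) (xbar : Ω → Fin n → ℝ)
    (w : ℕ → Ω → Fin n → ℝ) (SigW : Matrix (Fin n) (Fin n) ℝ) (k : ℕ) (pol : Policy n m) :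
    Prop where
  horizon : k ∈ Finset.Icc 2 S.ν
  measurable_init : Measurable xbar
  memLp_init : MemLp xbar 2 μ
  noise : IsIIDNoise μ w SigW
  indep : IndepFun xbar (fun ω (k : ℕ) => w (k + 1) ω) μ
  measurable_policy : ∀ t ∈ Finset.Icc (S.ν - k + 1) (S.ν - 1), Measurable (pol t)
  memLp_control : ∀ t ∈ Finset.Icc (S.ν - k + 1) (S.ν - 1),
    MemLp (fun ω => S.control k (xbar ω) pol (fun s => w s ω) t) 2 μ

namespace LinSys.ClosedLoop

variable {S : LinSys n m} {xbar : Ω → Fin n → ℝ} {w v : ℕ → Ω → Fin n → ℝ}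
  {SigW SigV : Matrix (Fin n) (Fin n) ℝ} {k : ℕ} {pol : Policy n m}

theorem memLp_state [IsProbabilityMeasure μ] (h : S.ClosedLoop μ xbar w SigW k pol) {t : ℕ}
    (ht : t ≤ S.ν) : MemLp (fun ω => S.state k (xbar ω) pol (fun s => w s ω) t) 2 μ := by
  induction t with
  | zero => exact h.memLp_init
  | succ t ih =>
    have ih := ih (by omega)
    by_cases hc : t ≤ S.ν - k
    · simpa only [LinSys.state, if_pos hc] using ih
    · have hu := h.memLp_control t (by simp only [Finset.mem_Icc]; omega)
      simp only [S.state_succ k _ pol _ (show S.ν - k + 1 ≤ t by omega)]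
      exact (((memLp_mulVec S.A ih).add (memLp_mulVec S.B hu)).add (memLp_const S.d)).add
        (h.noise.memLp t (by omega))

/-- The state at time `t` is a measurable function of `xbar` and `w 1, …, w (t-1)`, which are
jointly independent of `w t`. -/
theorem indepFun_noise [IsProbabilityMeasure μ] (h : S.ClosedLoop μ xbar w SigW k pol) {t : ℕ}
    (h1 : 1 ≤ t) (ht : t ≤ S.ν) :
    IndepFun (fun ω => S.state k (xbar ω) pol (fun s => w s ω) t) (w t) μ := by
  have hm : ∀ j : ℕ, Measurable fun ω => w (j + 1) ω := fun j => h.noise.measurable _ (by omega)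
  let past : Ω → (Finset.range (t - 1) → Fin n → ℝ) := fun ω j => w ((j : ℕ) + 1) ω
  have hpast : Measurable past := measurable_pi_lambda _ fun j => hm _
  have hw : Measurable (w t) := h.noise.measurable t h1
  have hpw : IndepFun past (w t) μ := by
    have := h.noise.indep.indepFun_finset (Finset.range (t - 1)) {t - 1} (by simp) hm
    have := this.comp measurable_id
      (measurable_pi_apply (⟨t - 1, by simp⟩ : ({t - 1} : Finset ℕ)))
    simp only [Function.comp_def, Nat.sub_add_cancel h1] at this
    exact this
  have hx : IndepFun xbar (fun ω => (past ω, w t ω)) μ := by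
    have hφ : Measurable fun e : ℕ → Fin n → ℝ =>
        ((fun j : Finset.range (t - 1) => e j), e (t - 1)) :=
      (measurable_pi_lambda _ fun j => measurable_pi_apply _).prodMk (measurable_pi_apply _)
    have := h.indep.comp measurable_id hφ
    simp only [Function.comp_def, Nat.sub_add_cancel h1] at this
    exact this
  have hall := indepFun_prodMk_of_indepFun h.measurable_init hpast hw hx hpw
  -- Pads the finite past by zeros to a full noise sequence; by `LinSys.state_congr` the padding
  -- does not affect the state at time `t`.
  let ext : (Fin n → ℝ) × (Finset.range (t - 1) → Fin n → ℝ) → ℕ → Fin n → ℝ := fun e s =>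
    if hs : s - 1 ∈ Finset.range (t - 1) then e.2 ⟨s - 1, hs⟩ else 0
  have hmeas := S.measurable_state k (fun _ => pol) Prod.fst ext
    (fun t ht => (h.measurable_policy t ht).comp measurable_snd) measurable_fst (t := t)
    (fun s hs1 hs2 => by
      have : s - 1 ∈ Finset.range (t - 1) := by simp only [Finset.mem_range]; omega
      simp only [ext, dif_pos this]
      exact (measurable_pi_apply _).comp measurable_snd) ht
  have := hall.comp hmeas measurable_id
  refine this.congr (Filter.Eventually.of_forall fun ω => ?_) (Filter.EventuallyEq.refl _ _)
  refine (S.state_congr k _ pol fun s hs1 hs2 => by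
    have hs : s - 1 ∈ Finset.range (t - 1) := by simp only [Finset.mem_range]; omega
    simp only [ext, dif_pos hs, past, Nat.sub_add_cancel hs1]).symm

/-- Here the whole sequence `w` can be used at once: the state is a function of `xbar` and `w`, and
this pair is independent of the sequence `v`. -/
theorem indepFun_measurementNoise [IsProbabilityMeasure μ]
    (h : S.ClosedLoop μ xbar w SigW k pol) (hv : IsIIDNoise μ v SigV)
    (hx : IndepFun xbar
      (fun ω => ((fun k : ℕ => w (k + 1) ω), (fun k : ℕ => v (k + 1) ω))) μ)
    (hwv : IndepFun (fun ω (k : ℕ) => w (k + 1) ω) (fun ω (k : ℕ) => v (k + 1) ω) μ) {t : ℕ}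
    (h1 : 1 ≤ t) (ht : t ≤ S.ν) :
    IndepFun (fun ω => S.state k (xbar ω) pol (fun s => w s ω) t) (v t) μ := by
  have hall := indepFun_prodMk_of_indepFun h.measurable_init h.noise.measurable_shift
    hv.measurable_shift hx hwv
  have hmeas := S.measurable_state k (fun _ => pol) Prod.fst
    (fun (e : (Fin n → ℝ) × (ℕ → Fin n → ℝ)) s => e.2 (s - 1))
    (fun t ht => (h.measurable_policy t ht).comp measurable_snd) measurable_fst (t := t)
    (fun s _ _ => (measurable_pi_apply _).comp measurable_snd) ht
  have := hall.comp hmeas (measurable_pi_apply (t - 1))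
  convert this using 1
  · funext ω
    refine S.state_congr k _ pol fun s hs1 hs2 => ?_
    simp only [Nat.sub_add_cancel hs1]
  · funext ω
    simp only [Function.comp_apply, Nat.sub_add_cancel h1]

/-- One step of the completion of squares, in expectation. -/
theorem integral_step [IsProbabilityMeasure μ] (h : S.ClosedLoop μ xbar w SigW k pol)
    (z : Candidate n) {t : ℕ} (ht : t ∈ Finset.Icc (S.ν - k + 1) (S.ν - 1))
    (hP : (z.P (t + 1)).IsSymm) :
    let x := fun t ω => S.state k (xbar ω) pol (fun s => w s ω) t
    let u := fun t ω => S.control k (xbar ω) pol (fun s => w s ω) t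
    ∫ ω, quadFun (z.P (t + 1)) (z.η (t + 1)) (x (t + 1) ω) ∂μ =
      ∫ ω, quadFun (z.P t) (z.η t) (x t ω) ∂μ
        + ((1 / 2) * ∫ ω, S.stageForm z t (u t ω) (x t ω) ∂μ
        - (∫ ω, quadFun z.Q z.q (x t ω) ∂μ + (1 / 2) * ∫ ω, u t ω ⬝ᵥ u t ω ∂μ)
        - ((1 / 2) * z.ξ t - (1 / 2) * (z.P (t + 1) * Matrix.vecMulVec S.d S.d).trace
          - z.η (t + 1) ⬝ᵥ S.d - (1 / 2) * (z.P (t + 1) * SigW).trace)) := by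
  intro x u
  have htI := ht
  rw [Finset.mem_Icc] at ht
  have hx : MemLp (x t) 2 μ := h.memLp_state (by omega)
  have hu : MemLp (u t) 2 μ := h.memLp_control t htI
  have hX : MemLp (fun ω => S.A *ᵥ x t ω + S.B *ᵥ u t ω + S.d) 2 μ :=
    ((memLp_mulVec S.A hx).add (memLp_mulVec S.B hu)).add (memLp_const S.d)
  -- Under state feedback the noise-free successor is a function of the current state alone.
  have hind : IndepFun (fun ω => S.A *ᵥ x t ω + S.B *ᵥ u t ω + S.d) (w t) μ := by
    have hf : Measurable fun y : Fin n → ℝ => S.A *ᵥ y + S.B *ᵥ pol t y + S.d :=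
      ((measurable_mulVec S.A).add ((measurable_mulVec S.B).comp
        (h.measurable_policy t htI))).add measurable_const
    have := (h.indepFun_noise (t := t) (by omega) (by omega)).comp hf measurable_id
    refine this.congr (Filter.Eventually.of_forall fun ω => ?_) (Filter.EventuallyEq.refl _ _)
    simp only [u, x, Function.comp_apply, S.control_active k _ pol _ ht.1]
  have hsucc : ∀ ω, x (t + 1) ω = (S.A *ᵥ x t ω + S.B *ᵥ u t ω + S.d) + w t ω := fun ω =>
    S.state_succ k _ pol _ ht.1
  simp_rw [hsucc]
  rw [integral_quadFun_add_noise hP _ hX (h.noise.memLp t (by omega))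
    (h.noise.mean t (by omega)) (h.noise.cov t (by omega)) hind]
  have i1 : Integrable (fun ω => (1 / 2) * S.stageForm z t (u t ω) (x t ω)) μ :=
    (S.integrable_stageForm z t hu hx).const_mul _
  have i2 := integrable_quadFun z.Q z.q hx
  have i3 : Integrable (fun ω => (1 / 2) * (u t ω ⬝ᵥ u t ω)) μ :=
    (integrable_dotProduct hu hu).const_mul _
  have i23 : Integrable (fun ω => quadFun z.Q z.q (x t ω) + (1 / 2) * (u t ω ⬝ᵥ u t ω)) μ :=
    i2.add i3
  have i123 : Integrable (fun ω => (1 / 2) * S.stageForm z t (u t ω) (x t ω)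
      - (quadFun z.Q z.q (x t ω) + (1 / 2) * (u t ω ⬝ᵥ u t ω))) μ := i1.sub i23
  have i4 := integrable_quadFun (z.P t) (z.η t) hx
  have i1234 : Integrable (fun ω => (1 / 2) * S.stageForm z t (u t ω) (x t ω)
      - (quadFun z.Q z.q (x t ω) + (1 / 2) * (u t ω ⬝ᵥ u t ω))
      + quadFun (z.P t) (z.η t) (x t ω)) μ := i123.add i4
  have hpt : ∀ ω, quadFun (z.P (t + 1)) (z.η (t + 1)) (S.A *ᵥ x t ω + S.B *ᵥ u t ω + S.d) =
      (1 / 2) * S.stageForm z t (u t ω) (x t ω)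
      - (quadFun z.Q z.q (x t ω) + (1 / 2) * (u t ω ⬝ᵥ u t ω))
      + quadFun (z.P t) (z.η t) (x t ω) + (-(1 / 2) * z.ξ t
      + (1 / 2) * (z.P (t + 1) * Matrix.vecMulVec S.d S.d).trace + z.η (t + 1) ⬝ᵥ S.d) := by
    intro ω
    rw [S.quadFun_step z t hP]
    ring
  simp_rw [hpt]
  rw [integral_add i1234 (integrable_const _), integral_add i123 i4, integral_sub i1 i23,
    integral_add i2 i3, integral_const_mul, integral_const_mul]
  simp only [integral_const, probReal_univ, one_smul]
  ring

/-- The completion of squares along the whole trajectory. -/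
theorem integral_telescope [IsProbabilityMeasure μ] (h : S.ClosedLoop μ xbar w SigW k pol)
    (z : Candidate n) (hP : ∀ t ∈ Finset.Icc 1 S.ν, (z.P t).IsSymm) :
    let x := fun t ω => S.state k (xbar ω) pol (fun s => w s ω) t
    let u := fun t ω => S.control k (xbar ω) pol (fun s => w s ω) t
    ∫ ω, quadFun (z.P S.ν) (z.η S.ν) (x S.ν ω) ∂μ
      - ∫ ω, quadFun (z.P (S.ν - k + 1)) (z.η (S.ν - k + 1)) (x (S.ν - k + 1) ω) ∂μ =
      ∑ t ∈ Finset.Icc (S.ν - k + 1) (S.ν - 1),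
        ((1 / 2) * ∫ ω, S.stageForm z t (u t ω) (x t ω) ∂μ
        - (∫ ω, quadFun z.Q z.q (x t ω) ∂μ + (1 / 2) * ∫ ω, u t ω ⬝ᵥ u t ω ∂μ)
        - ((1 / 2) * z.ξ t - (1 / 2) * (z.P (t + 1) * Matrix.vecMulVec S.d S.d).trace
          - z.η (t + 1) ⬝ᵥ S.d - (1 / 2) * (z.P (t + 1) * SigW).trace)) := by
  intro x u
  have hk := Finset.mem_Icc.1 h.horizon
  have hI : Finset.Icc (S.ν - k + 1) (S.ν - 1) = Finset.Ico (S.ν - k + 1) S.ν := by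
    ext t; simp only [Finset.mem_Icc, Finset.mem_Ico]; omega
  rw [← Finset.sum_Ico_sub (fun t => ∫ ω, quadFun (z.P t) (z.η t) (x t ω) ∂μ)
    (show S.ν - k + 1 ≤ S.ν by omega), ← hI]
  refine Finset.sum_congr rfl fun t ht => ?_
  rw [h.integral_step z ht (hP _ (by simp only [Finset.mem_Icc] at *; omega))]
  ring

end LinSys.ClosedLoop

/-- The closed loop of an affine feedback is square integrable. -/
theorem LinSys.closedLoop_of_affine [IsProbabilityMeasure μ] (S : LinSys n m)
    {xbar : Ω → Fin n → ℝ} {w : ℕ → Ω → Fin n → ℝ} {SigW : Matrix (Fin n) (Fin n) ℝ} {k : ℕ}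
    (hk : k ∈ Finset.Icc 2 S.ν) (hxm : Measurable xbar) (hx : MemLp xbar 2 μ)
    (hw : IsIIDNoise μ w SigW) (hind : IndepFun xbar (fun ω (k : ℕ) => w (k + 1) ω) μ)
    (pol : Policy n m) (K : ℕ → Matrix (Fin m) (Fin n) ℝ) (κ : ℕ → Fin m → ℝ)
    (hpol : ∀ t x, pol t x = K t *ᵥ x + κ t) : S.ClosedLoop μ xbar w SigW k pol := by
  have hstate : ∀ t, MemLp (fun ω => S.state k (xbar ω) pol (fun s => w s ω) t) 2 μ := by
    intro t
    induction t with
    | zero => exact hx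
    | succ t ih =>
      by_cases hc : t ≤ S.ν - k
      · simpa only [LinSys.state, if_pos hc] using ih
      · simp only [LinSys.state, if_neg hc, hpol]
        exact (((memLp_mulVec S.A ih).add (memLp_mulVec S.B
          ((memLp_mulVec (K t) ih).add (memLp_const _)))).add (memLp_const S.d)).add
          (hw.memLp t (by omega))
  refine ⟨hk, hxm, hx, hw, hind, fun t _ => ?_, fun t ht => ?_⟩
  · rw [show pol t = fun x => K t *ᵥ x + κ t from funext (hpol t)]
    exact (measurable_mulVec _).add measurable_const
  · simp only [S.control_active k _ pol _ (Finset.mem_Icc.1 ht).1, hpol]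
    exact (memLp_mulVec _ (hstate t)).add (memLp_const _)

/-- An admissible strategy from a deterministic initial state. -/
theorem LinSys.IsAdmissible.closedLoop [IsProbabilityMeasure μ] {S : LinSys n m}
    {w : ℕ → Ω → Fin n → ℝ} {SigW : Matrix (Fin n) (Fin n) ℝ} {k : ℕ}
    (hk : k ∈ Finset.Icc 2 S.ν) (hw : IsIIDNoise μ w SigW) {x₁ : Fin n → ℝ} {pol : Policy n m}
    (h : S.IsAdmissible μ w k x₁ pol) : S.ClosedLoop μ (fun _ => x₁) w SigW k pol :=
  ⟨hk, measurable_const, memLp_const x₁, hw, indepFun_const_left _ _,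
    fun t ht => (h t ht).1, fun t ht => (h t ht).2⟩

theorem LinSys.ClosedLoop.isAdmissible {S : LinSys n m}
    {w : ℕ → Ω → Fin n → ℝ} {SigW : Matrix (Fin n) (Fin n) ℝ} {k : ℕ} {x₁ : Fin n → ℝ}
    {pol : Policy n m} (h : S.ClosedLoop μ (fun _ => x₁) w SigW k pol) :
    S.IsAdmissible μ w k x₁ pol :=
  fun t ht => ⟨h.measurable_policy t ht, h.memLp_control t ht⟩

/-! ### The forward problem: definiteness and optimal strategies -/

/-- The part of the optimal cost that the strategy cannot influence. -/
noncomputable def LinSys.baseCost (S : LinSys n m) (SigW : Matrix (Fin n) (Fin n) ℝ)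
    (z : Candidate n) (k : ℕ) (x₁ : Fin n → ℝ) : ℝ :=
  quadFun (z.P (S.ν - k + 1)) (z.η (S.ν - k + 1)) x₁ -
    ∑ t ∈ Finset.Icc (S.ν - k + 1) (S.ν - 1),
      ((1 / 2) * z.ξ t - (1 / 2) * (z.P (t + 1) * Matrix.vecMulVec S.d S.d).trace
          - z.η (t + 1) ⬝ᵥ S.d - (1 / 2) * (z.P (t + 1) * SigW).trace)

/-- The expected cost, with squares completed. -/
theorem LinSys.cost_eq [IsProbabilityMeasure μ] (S : LinSys n m)
    {w : ℕ → Ω → Fin n → ℝ} {SigW : Matrix (Fin n) (Fin n) ℝ} {k : ℕ} {x₁ : Fin n → ℝ}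
    {pol : Policy n m} (h : S.ClosedLoop μ (fun _ => x₁) w SigW k pol)
    (z : Candidate n) (hP : ∀ t ∈ Finset.Icc 1 S.ν, (z.P t).IsSymm) (hPν : z.P S.ν = z.Q)
    (hην : z.η S.ν = z.q) :
    S.cost μ w z.Q z.q 1 k x₁ pol = S.baseCost SigW z k x₁ +
      ∑ t ∈ Finset.Icc (S.ν - k + 1) (S.ν - 1), (1 / 2) *
        ∫ ω, S.stageForm z t (S.control k x₁ pol (fun s => w s ω) t)
          (S.state k x₁ pol (fun s => w s ω) t) ∂μ := by
  have hx := fun t (ht : t ≤ S.ν) => h.memLp_state ht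
  have hu := fun t ht => h.memLp_control t ht
  have htel := h.integral_telescope z hP
  have hk := Finset.mem_Icc.1 h.horizon
  simp only [S.state_initial k x₁ pol _ le_rfl, integral_const, probReal_univ, one_smul] at htel
  have hi : ∀ t ∈ Finset.Icc (S.ν - k + 1) (S.ν - 1), Integrable (fun ω =>
      quadFun z.Q z.q (S.state k x₁ pol (fun s => w s ω) t) +
      (1 / 2) * (S.control k x₁ pol (fun s => w s ω) t ⬝ᵥ
        S.control k x₁ pol (fun s => w s ω) t)) μ := fun t ht =>
    (integrable_quadFun z.Q z.q (hx t (by simp only [Finset.mem_Icc] at ht; omega))).add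
      ((integrable_dotProduct (hu t ht) (hu t ht)).const_mul _)
  have hc : S.cost μ w z.Q z.q 1 k x₁ pol =
      ∫ ω, quadFun z.Q z.q (S.state k x₁ pol (fun s => w s ω) S.ν) ∂μ
      + ∑ t ∈ Finset.Icc (S.ν - k + 1) (S.ν - 1),
        (∫ ω, quadFun z.Q z.q (S.state k x₁ pol (fun s => w s ω) t) ∂μ +
        (1 / 2) * ∫ ω, S.control k x₁ pol (fun s => w s ω) t ⬝ᵥ
          S.control k x₁ pol (fun s => w s ω) t ∂μ) := by
    have e : ∀ t ∈ Finset.Icc (S.ν - k + 1) (S.ν - 1),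
        ∫ ω, quadFun z.Q z.q (S.state k x₁ pol (fun s => w s ω) t) ∂μ +
        (1 / 2) * ∫ ω, S.control k x₁ pol (fun s => w s ω) t ⬝ᵥ
          S.control k x₁ pol (fun s => w s ω) t ∂μ =
        ∫ ω, (quadFun z.Q z.q (S.state k x₁ pol (fun s => w s ω) t) +
        (1 / 2) * (S.control k x₁ pol (fun s => w s ω) t ⬝ᵥ
          S.control k x₁ pol (fun s => w s ω) t)) ∂μ := by
      intro t ht
      rw [integral_add (integrable_quadFun z.Q z.q
        (hx t (by simp only [Finset.mem_Icc] at ht; omega)))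
        ((integrable_dotProduct (hu t ht) (hu t ht)).const_mul _), integral_const_mul]
    rw [Finset.sum_congr rfl e, ← integral_finsetSum _ hi, ← integral_add
      (integrable_quadFun z.Q z.q (hx S.ν le_rfl)) (integrable_finsetSum _ hi)]
    simp only [LinSys.cost, quadFun, one_mulVec]
  rw [hPν, hην] at htel
  rw [hc, LinSys.baseCost]
  rw [Finset.sum_sub_distrib, Finset.sum_sub_distrib] at htel
  linarith
/-- The gain of the affine feedback. -/
noncomputable def LinSys.gain (S : LinSys n m) (z : Candidate n) (t : ℕ) :
    Matrix (Fin m) (Fin n) ℝ :=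
  -(pinv (S.fR 1 (z.P (t + 1))) * S.fS (z.P (t + 1)))

/-- The offset of the affine feedback. -/
noncomputable def LinSys.offset (S : LinSys n m) (z : Candidate n) (t : ℕ) : Fin m → ℝ :=
  -(pinv (S.fR 1 (z.P (t + 1))) *ᵥ S.g (z.P (t + 1)) (z.η (t + 1)))

theorem LinSys.feedback_eq (S : LinSys n m) (z : Candidate n) (t : ℕ) (x : Fin n → ℝ) :
    S.feedback z t x = S.gain z t *ᵥ x + S.offset z t := by
  rw [LinSys.feedback, LinSys.gain, LinSys.offset, mulVec_add, neg_mulVec, mulVec_mulVec, neg_add]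

theorem LinSys.measurable_feedback (S : LinSys n m) (z : Candidate n) (t : ℕ) :
    Measurable (S.feedback z t) := by
  rw [show S.feedback z t = _ from funext (S.feedback_eq z t)]
  exact (measurable_mulVec _).add measurable_const

theorem LinSys.truth_P_isSymm (S : LinSys n m) {Q : Matrix (Fin n) (Fin n) ℝ} (hQ : Q.IsSymm)
    (q : Fin n → ℝ) (t : ℕ) : ((S.truth Q q).P t).IsSymm := S.riccati_isSymm hQ q _

theorem LinSys.truth_P_last (S : LinSys n m) (Q : Matrix (Fin n) (Fin n) ℝ) (q : Fin n → ℝ) :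
    (S.truth Q q).P S.ν = Q := by simp [LinSys.truth, LinSys.riccati]

theorem LinSys.truth_η_last (S : LinSys n m) (Q : Matrix (Fin n) (Fin n) ℝ) (q : Fin n → ℝ) :
    (S.truth Q q).η S.ν = q := by simp [LinSys.truth, LinSys.riccati]

theorem LinSys.truth_stageForm_feedback (S : LinSys n m) {Q : Matrix (Fin n) (Fin n) ℝ}
    (hQ : Q.IsSymm) (q : Fin n → ℝ) {t : ℕ} (ht : t < S.ν)
    (h : (S.fR 1 ((S.truth Q q).P (t + 1))).PosDef) (x : Fin n → ℝ) :
    S.stageForm (S.truth Q q) t (S.feedback (S.truth Q q) t x) x = 0 := by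
  rw [S.truth_stageForm hQ q ht h, sub_self, zero_dotProduct]

theorem abs_apply_le_l2norm {k : ℕ} (v : Fin k → ℝ) (i : Fin k) : |v i| ≤ l2norm v := by
  rw [← Real.norm_eq_abs]
  exact PiLp.norm_apply_le (WithLp.toLp 2 v) i

/-- Under persistent excitation no affine function vanishes almost surely at the initial
state. -/
theorem PersistentExcitation.eq_zero_of_ae {ν : ℕ} {xbar : Ω → Fin n → ℝ} {N : Ω → ℕ}
    (h : PersistentExcitation ν μ xbar N) {k : ℕ} (hk : k ∈ Finset.Icc 2 ν)
    (hpos : 0 < μ {ω | N ω = k}) {a : Fin n → ℝ} {b : ℝ}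
    (hab : ∀ᵐ ω ∂(condHorizon μ N k), a ⬝ᵥ xbar ω + b = 0) : a = 0 ∧ b = 0 := by
  -- A continuous function vanishing almost surely vanishes on the support, in particular at `ρ •
  -- χ`. Below, `χ = 0` yields `b = 0` and `χ = a` yields `ρ |a|² = 0`.
  have key : ∀ χ : Fin n → ℝ, ∃ ρ : ℝ, 0 < ρ ∧ ρ * (a ⬝ᵥ χ) + b = 0 := by
    intro χ
    obtain ⟨ρ, hρ, hsupp⟩ := h.excite k hk hpos χ
    refine ⟨ρ, hρ, ?_⟩
    by_contra hne
    have hcont : Continuous fun y : Fin n → ℝ => a ⬝ᵥ y + b :=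
      (continuous_const.dotProduct continuous_id).add continuous_const
    have hne' : a ⬝ᵥ (ρ • χ) + b ≠ 0 := by rwa [dotProduct_smul, smul_eq_mul]
    obtain ⟨ε, hε, hball⟩ := Metric.isOpen_iff.1 (isOpen_ne.preimage hcont) (ρ • χ) hne'
    refine (hsupp ε hε).ne' (measure_mono_null (fun ω hω => ?_) (ae_iff.1 hab))
    refine hball ?_
    rw [Metric.mem_ball, dist_comm, dist_eq_norm, pi_norm_lt_iff hε]
    exact fun i => (abs_apply_le_l2norm _ i).trans_lt hω
  have hb : b = 0 := by
    obtain ⟨ρ, _, hρ⟩ := key 0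
    simpa using hρ
  refine ⟨?_, hb⟩
  obtain ⟨ρ, h0, hρ⟩ := key a
  rw [hb, add_zero] at hρ
  exact dotProduct_self_eq_zero.1 ((mul_eq_zero.1 hρ).resolve_left h0.ne')

/-- Extracts from a lower bound on the cost the second-order condition and, in degenerate
directions, the first-order condition. -/
theorem nonneg_of_quadratic_bddBelow {a c b : ℝ} (h : ∀ r : ℝ, b ≤ r ^ 2 * a + r * c) :
    0 ≤ a ∧ (a = 0 → c = 0) := by
  have hlin : ∀ c' : ℝ, (∀ r : ℝ, b ≤ r * c') → c' = 0 := by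
    intro c' hc
    by_contra hne
    have := hc ((b - 1) / c')
    rw [div_mul_cancel₀ _ hne] at this
    linarith
  refine ⟨?_, fun ha => hlin c fun r => by simpa [ha] using h r⟩
  by_contra! ha
  -- Averaging the bounds at `r` and `-r` removes the linear term.
  have hsum : ∀ r : ℝ, b ≤ r ^ 2 * a := by
    intro r
    have h1 := h r
    have h2 := h (-r)
    nlinarith
  -- At this point `r ^ 2 * a ≤ a - 2|b|`, which is below `b`.
  have hs := hsum (1 + |b| / (-a))
  have h1 : 0 ≤ |b| / (-a) := div_nonneg (abs_nonneg b) (by linarith)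
  have h2 : |b| / (-a) * a = -|b| := by
    rw [div_mul_eq_mul_div, div_neg, mul_div_cancel_right₀ _ ha.ne]
  nlinarith [neg_abs_le b, mul_nonneg h1 (abs_nonneg b)]

/-- Solvability of the forward problems makes every `𝔑 t` positive definite. -/
theorem LinSys.truth_fR_posDef [IsProbabilityMeasure μ] (S : LinSys n m) (hA : IsUnit S.A)
    {xbar : Ω → Fin n → ℝ} {N : Ω → ℕ} {w : ℕ → Ω → Fin n → ℝ}
    {SigW : Matrix (Fin n) (Fin n) ℝ} (hw : IsIIDNoise μ w SigW)
    (hN : HorizonAssumption n S.ν μ N) (hν : 2 ≤ S.ν) (hx : PersistentExcitation S.ν μ xbar N)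
    {Q : Matrix (Fin n) (Fin n) ℝ} {q : Fin n → ℝ} (hQq : (Q, q) ∈ S.wellPosed μ w xbar 1) :
    ∀ t ∈ Finset.Icc 1 (S.ν - 1), (S.fR 1 ((S.truth Q q).P (t + 1))).PosDef := by
  obtain ⟨hQ, hsolv⟩ := hQq
  have hQ : Q.IsSymm := hQ
  set z := S.truth Q q with hz
  have hsymm : ∀ t, (z.P t).IsSymm := S.truth_P_isSymm hQ q
  suffices H : ∀ j, ∀ t, 1 ≤ t → t ≤ S.ν - 1 → S.ν - 1 - t = j →
      (S.fR 1 (z.P (t + 1))).PosDef from fun t ht => H _ t (Finset.mem_Icc.1 ht).1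
        (Finset.mem_Icc.1 ht).2 rfl
  intro j
  induction j using Nat.strong_induction_on with
  | _ j ih =>
  intro t ht1 ht2 hj
  have hlater : ∀ s, t < s → s ≤ S.ν - 1 → (S.fR 1 (z.P (s + 1))).PosDef := fun s h1 h2 =>
    ih (S.ν - 1 - s) (by omega) s (by omega) h2 rfl
  -- This horizon makes `t` the first active time, so the state there is the given `x₁`.
  have hk : S.ν - t + 1 ∈ Finset.Icc 2 S.ν := by simp only [Finset.mem_Icc]; omega
  have hkt : S.ν - (S.ν - t + 1) + 1 = t := by omega
  have hbdd : ∀ᵐ ω ∂μ, ∃ b : ℝ, ∀ c : Fin m → ℝ, b ≤ S.stageForm z t c (xbar ω) := by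
    filter_upwards [ae_of_ae_map hx.measurable.aemeasurable (hsolv _ hk)] with ω hω
    obtain ⟨pol, -, hpol⟩ := hω
    set x₁ := xbar ω
    refine ⟨2 * (S.cost μ w Q q 1 (S.ν - t + 1) x₁ pol - S.baseCost SigW z (S.ν - t + 1) x₁),
      fun c => ?_⟩
    -- An arbitrary first control followed by the affine feedback: by the induction hypothesis all
    -- later forms vanish, so the cost is the base cost plus half the form at `(c, x₁)`. Of the
    -- minimizer only its cost, as a lower bound, is used.
    let pc : Policy n m := fun s x => if s = t then c else S.feedback z s x
    have hcl : S.ClosedLoop μ (fun _ => x₁) w SigW (S.ν - t + 1) pc :=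
      S.closedLoop_of_affine hk measurable_const (memLp_const _) hw (indepFun_const_left _ _) pc
        (fun s => if s = t then 0 else S.gain z s) (fun s => if s = t then c else S.offset z s)
        (fun s x => by
          by_cases hs : s = t
          · simp [pc, hs]
          · simp [pc, hs, S.feedback_eq])
    have hle := hpol pc hcl.isAdmissible
    have hcost := S.cost_eq hcl z (fun t _ => hsymm t) (S.truth_P_last Q q) (S.truth_η_last Q q)
    rw [hkt, Finset.sum_eq_single_of_mem t (by simp only [Finset.mem_Icc]; omega)] at hcost
    · have e1 : ∀ ω', S.state (S.ν - t + 1) x₁ pc (fun s => w s ω') t = x₁ := fun ω' =>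
        S.state_initial _ _ _ _ (by omega)
      have e2 : ∀ ω', S.control (S.ν - t + 1) x₁ pc (fun s => w s ω') t = c := fun ω' => by
        rw [S.control_active _ _ _ _ (by omega)]; simp [pc]
      simp only [e1, e2, integral_const, probReal_univ, one_smul] at hcost
      change S.cost μ w Q q 1 _ _ _ = _ at hcost
      linarith
    · intro s hs hst
      rw [Finset.mem_Icc] at hs
      have e3 : ∀ ω', S.stageForm z s (S.control (S.ν - t + 1) x₁ pc (fun s => w s ω') s)
          (S.state (S.ν - t + 1) x₁ pc (fun s => w s ω') s) = 0 := fun ω' => by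
        rw [S.control_active _ _ _ _ (by omega)]
        simp only [pc, if_neg hst]
        exact S.truth_stageForm_feedback hQ q (by omega) (hlater s (by omega) hs.2) _
      simp only [e3, integral_zero, mul_zero]
  have hquad : ∀ᵐ ω ∂μ, ∀ c : Fin m → ℝ, 0 ≤ c ⬝ᵥ S.fR 1 (z.P (t + 1)) *ᵥ c ∧
      (c ⬝ᵥ S.fR 1 (z.P (t + 1)) *ᵥ c = 0 → c ⬝ᵥ S.fS (z.P (t + 1)) *ᵥ xbar ω +
        c ⬝ᵥ S.g (z.P (t + 1)) (z.η (t + 1)) = 0) := by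
    filter_upwards [hbdd] with ω ⟨b, hb⟩ c
    have := nonneg_of_quadratic_bddBelow (a := c ⬝ᵥ S.fR 1 (z.P (t + 1)) *ᵥ c)
      (c := 2 * (c ⬝ᵥ S.fS (z.P (t + 1)) *ᵥ xbar ω + c ⬝ᵥ S.g (z.P (t + 1)) (z.η (t + 1))))
      (b := b - (xbar ω ⬝ᵥ (S.Aᵀ * z.P (t + 1) * S.A + z.Q - z.P t) *ᵥ xbar ω
        + 2 * (S.β z t ⬝ᵥ xbar ω) + z.ξ t)) fun r => by
      have := hb (r • c)
      simp only [LinSys.stageForm, mulVec_smul, smul_dotProduct, dotProduct_smul,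
        smul_eq_mul] at this
      linarith
    exact ⟨this.1, fun h => by linarith [this.2 h]⟩
  refine S.fR_posDef hA (hsymm _) ?_ fun c hc x => ?_
  · obtain ⟨ω, hω⟩ := hquad.exists
    exact fun c => (hω c).1
  -- For a kernel vector the linear term vanishes at almost every initial state; excitation given
  -- the longest horizon then forces `𝔖ᵀ c = 0`.
  · have hae : ∀ᵐ ω ∂(condHorizon μ N S.ν), ((S.fS (z.P (t + 1)))ᵀ *ᵥ c) ⬝ᵥ xbar ω +
        c ⬝ᵥ S.g (z.P (t + 1)) (z.η (t + 1)) = 0 := by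
      refine (cond_absolutelyContinuous (μ := μ)).ae_le ?_
      filter_upwards [hquad] with ω hω
      rw [transpose_mulVec_dotProduct]
      exact (hω c).2 (by rw [hc, dotProduct_zero])
    have h0 := (hx.eq_zero_of_ae (Finset.mem_Icc.2 ⟨hν, le_rfl⟩) hN.pos hae).1
    rw [← transpose_mulVec_dotProduct, h0, zero_dotProduct]

/-- An optimal strategy almost surely acts as the affine feedback. -/
theorem LinSys.IsOptimal.control_eq_feedback [IsProbabilityMeasure μ] {S : LinSys n m}
    {w : ℕ → Ω → Fin n → ℝ} {SigW : Matrix (Fin n) (Fin n) ℝ} (hw : IsIIDNoise μ w SigW)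
    {Q : Matrix (Fin n) (Fin n) ℝ} {q : Fin n → ℝ} (hQ : Q.IsSymm)
    (hR : ∀ t ∈ Finset.Icc 1 (S.ν - 1), (S.fR 1 ((S.truth Q q).P (t + 1))).PosDef)
    {k : ℕ} (hk : k ∈ Finset.Icc 2 S.ν) {x₁ : Fin n → ℝ} {pol : Policy n m}
    (h : S.IsOptimal μ w Q q 1 k x₁ pol) :
    ∀ᵐ ω ∂μ, ∀ t ∈ Finset.Icc (S.ν - k + 1) (S.ν - 1),
      S.control k x₁ pol (fun s => w s ω) t =
        S.feedback (S.truth Q q) t (S.state k x₁ pol (fun s => w s ω) t) := by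
  set z := S.truth Q q with hz
  have hsymm : ∀ t, (z.P t).IsSymm := S.truth_P_isSymm hQ q
  have hcl := h.1.closedLoop hk hw
  have hcf : S.ClosedLoop μ (fun _ => x₁) w SigW k (S.feedback z) :=
    S.closedLoop_of_affine hk measurable_const (memLp_const _) hw (indepFun_const_left _ _) _
      (S.gain z) (S.offset z) (S.feedback_eq z)
  -- The affine feedback costs exactly the base cost, so every nonnegative excess term of an optimal
  -- strategy is zero.
  have hle := h.2 _ hcf.isAdmissible
  have c1 := S.cost_eq hcl z (fun t _ => hsymm t) (S.truth_P_last Q q) (S.truth_η_last Q q)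
  have c2 := S.cost_eq hcf z (fun t _ => hsymm t) (S.truth_P_last Q q) (S.truth_η_last Q q)
  have hmem : ∀ t ∈ Finset.Icc (S.ν - k + 1) (S.ν - 1), t < S.ν ∧
      (S.fR 1 (z.P (t + 1))).PosDef := by
    intro t ht
    rw [Finset.mem_Icc] at ht hk
    exact ⟨by omega, hR t (by simp only [Finset.mem_Icc]; omega)⟩
  rw [Finset.sum_eq_zero (fun t ht => by
    have e : ∀ ω', S.stageForm z t (S.control k x₁ (S.feedback z) (fun s => w s ω') t)
        (S.state k x₁ (S.feedback z) (fun s => w s ω') t) = 0 := fun ω' => by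
      rw [S.control_active _ _ _ _ (Finset.mem_Icc.1 ht).1]
      exact S.truth_stageForm_feedback hQ q (hmem t ht).1 (hmem t ht).2 _
    simp only [e, integral_zero, mul_zero]), add_zero] at c2
  change S.cost μ w Q q 1 _ _ _ = _ at c1 c2
  have hnn : ∀ t ∈ Finset.Icc (S.ν - k + 1) (S.ν - 1), ∀ u x, 0 ≤ S.stageForm z t u x :=
    fun t ht => S.stageForm_nonneg (S.truth_H_posSemidef hQ q (hmem t ht).1 (hmem t ht).2)
  have hnn' : ∀ t ∈ Finset.Icc (S.ν - k + 1) (S.ν - 1), 0 ≤ (1 / 2) *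
      ∫ ω, S.stageForm z t (S.control k x₁ pol (fun s => w s ω) t)
          (S.state k x₁ pol (fun s => w s ω) t) ∂μ := fun t ht =>
    mul_nonneg (by norm_num) (integral_nonneg fun ω => hnn t ht _ _)
  have hzero := (Finset.sum_eq_zero_iff_of_nonneg hnn').1
    (le_antisymm (by linarith) (Finset.sum_nonneg hnn'))
  refine (ae_ball_iff (Finset.countable_toSet _)).2 fun t ht => ?_
  have hi := S.integrable_stageForm z t (hcl.memLp_control t ht)
    (hcl.memLp_state (hmem t ht).1.le)
  have h0 := (integral_eq_zero_iff_of_nonneg (fun ω => hnn t ht _ _) hi).1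
    ((mul_eq_zero.1 (hzero t ht)).resolve_left (by norm_num))
  filter_upwards [h0] with ω hω
  simp only [Pi.zero_apply] at hω
  rw [S.truth_stageForm hQ q (hmem t ht).1 (hmem t ht).2] at hω
  by_contra hne
  have := (hmem t ht).2.dotProduct_mulVec_pos (sub_ne_zero.2 hne)
  rw [star_trivial] at this
  exact this.ne' hω

/-- A strategy that acts as `fb` along its own trajectory has the trajectory of `fb`. -/
theorem LinSys.trajectory_eq (S : LinSys n m) {k : ℕ} {x₁ : Fin n → ℝ} {pol fb : Policy n m}
    {w : ℕ → Fin n → ℝ} (h : ∀ t ∈ Finset.Icc (S.ν - k + 1) (S.ν - 1),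
      S.control k x₁ pol w t = fb t (S.state k x₁ pol w t)) :
    (∀ t ≤ S.ν, S.state k x₁ pol w t = S.state k x₁ fb w t) ∧
      ∀ t < S.ν, S.control k x₁ pol w t = S.control k x₁ fb w t := by
  have hst : ∀ t ≤ S.ν, S.state k x₁ pol w t = S.state k x₁ fb w t := by
    intro t
    induction t with
    | zero => intro _; rfl
    | succ t ih =>
      intro ht
      by_cases hc : t ≤ S.ν - k
      · rw [S.state_initial _ _ _ _ (by omega), S.state_initial _ _ _ _ (by omega)]
      · rw [S.state_succ _ _ _ _ (by omega), S.state_succ _ _ _ _ (by omega),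
          h t (by simp only [Finset.mem_Icc]; omega), S.control_active _ _ fb _ (by omega),
          ih (by omega)]
  refine ⟨hst, fun t ht => ?_⟩
  by_cases hc : t ≤ S.ν - k
  · rw [S.control_initial _ _ _ _ hc, S.control_initial _ _ _ _ hc]
  · rw [h t (by simp only [Finset.mem_Icc]; omega), S.control_active _ _ fb _ (by omega),
      hst t ht.le]

/-- The trajectory of the agent is almost surely that of the affine feedback. -/
theorem LinSys.agent_eq_feedback [IsProbabilityMeasure μ] (S : LinSys n m)
    {xbar : Ω → Fin n → ℝ} {N : Ω → ℕ} {w : ℕ → Ω → Fin n → ℝ}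
    {SigW : Matrix (Fin n) (Fin n) ℝ} (hw : IsIIDNoise μ w SigW)
    (hxm : Measurable xbar) (hNm : Measurable N)
    (hind : IndepFun (fun ω => (xbar ω, N ω)) (fun ω (k : ℕ) => w (k + 1) ω) μ)
    {Q : Matrix (Fin n) (Fin n) ℝ} {q : Fin n → ℝ} (hQ : Q.IsSymm)
    (hR : ∀ t ∈ Finset.Icc 1 (S.ν - 1), (S.fR 1 ((S.truth Q q).P (t + 1))).PosDef)
    {π : ℕ → (Fin n → ℝ) → Policy n m}
    (hπ : ∀ k t, Measurable (fun p : (Fin n → ℝ) × (Fin n → ℝ) => π k p.1 t p.2))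
    (hopt : ∀ᵐ ω ∂μ, S.IsOptimal μ w Q q 1 (N ω) (xbar ω) (π (N ω) (xbar ω))) {k : ℕ}
    (hk : k ∈ Finset.Icc 2 S.ν) :
    ∀ᵐ ω ∂μ, N ω = k →
      (∀ t ≤ S.ν, S.agentState π xbar N w t ω =
        S.state k (xbar ω) (S.feedback (S.truth Q q)) (fun s => w s ω) t) ∧
      ∀ t < S.ν, S.agentControl π xbar N w t ω =
        S.control k (xbar ω) (S.feedback (S.truth Q q)) (fun s => w s ω) t := by
  set fb := S.feedback (S.truth Q q) with hfb
  have hwm := hw.measurable_shift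
  have hxN : Measurable fun ω => (xbar ω, N ω) := hxm.prodMk hNm
  -- Trajectories as functions of the pair (initial data, noise path), so that initial data and
  -- noise can be sampled separately.
  let st : ((Fin n → ℝ) × ℕ) × (ℕ → Fin n → ℝ) → ℕ → Fin n → ℝ := fun p t =>
    S.state k p.1.1 (π k p.1.1) (fun s => p.2 (s - 1)) t
  let ct : ((Fin n → ℝ) × ℕ) × (ℕ → Fin n → ℝ) → ℕ → Fin m → ℝ := fun p t =>
    S.control k p.1.1 (π k p.1.1) (fun s => p.2 (s - 1)) t
  have hst : ∀ (ω ω' : Ω) (t : ℕ), st ((xbar ω, N ω), fun k => w (k + 1) ω') t =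
      S.state k (xbar ω) (π k (xbar ω)) (fun s => w s ω') t := fun ω ω' t =>
    S.state_congr _ _ _ fun s h1 _ => by simp only [Nat.sub_add_cancel h1]
  have hct : ∀ (ω ω' : Ω) (t : ℕ), ct ((xbar ω, N ω), fun k => w (k + 1) ω') t =
      S.control k (xbar ω) (π k (xbar ω)) (fun s => w s ω') t := fun ω ω' t => by
    have := hst ω ω' t
    simp only [st, ct, LinSys.control] at this ⊢
    rw [this]
  let T := Finset.Icc (S.ν - k + 1) (S.ν - 1)
  let A : Set (((Fin n → ℝ) × ℕ) × (ℕ → Fin n → ℝ)) :=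
    {p | p.1.2 = k → ∀ t ∈ T, ct p t = fb t (st p t)}
  -- The Fubini argument needs a measurable set; this uses the joint measurability of the strategies
  -- in initial state and current state.
  have hAm : MeasurableSet A := by
    have h1 : MeasurableSet {p : ((Fin n → ℝ) × ℕ) × (ℕ → Fin n → ℝ) | p.1.2 = k} :=
      (measurable_snd.comp measurable_fst) (measurableSet_singleton k)
    have h2 : MeasurableSet {p : ((Fin n → ℝ) × ℕ) × (ℕ → Fin n → ℝ) |
        ∀ t ∈ T, ct p t = fb t (st p t)} := by
      simp only [Set.ofPred_forall]
      refine Finset.measurableSet_biInter T fun t ht => ?_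
      have ht := Finset.mem_Icc.1 ht
      have hp : ∀ t ∈ T, Measurable fun p : (((Fin n → ℝ) × ℕ) × (ℕ → Fin n → ℝ)) ×
          (Fin n → ℝ) => π k p.1.1.1 t p.2 := fun t _ => (hπ k t).comp
        ((measurable_fst.comp (measurable_fst.comp measurable_fst)).prodMk measurable_snd)
      have hs : ∀ s, 1 ≤ s → s < t → Measurable fun p : ((Fin n → ℝ) × ℕ) ×
          (ℕ → Fin n → ℝ) => p.2 (s - 1) := fun s _ _ =>
        (measurable_pi_apply _).comp measurable_snd
      exact measurableSet_eq_fun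
        (S.measurable_control k (fun p => π k p.1.1) (fun p => p.1.1) _ hp
          (measurable_fst.comp measurable_fst) hs (by omega))
        ((S.measurable_feedback _ t).comp (S.measurable_state k (fun p => π k p.1.1)
          (fun p => p.1.1) _ hp (measurable_fst.comp measurable_fst) hs (by omega)))
    have : A = {p | p.1.2 = k}ᶜ ∪ {p | ∀ t ∈ T, ct p t = fb t (st p t)} := by
      ext p; simp only [A, Set.mem_ofPred_eq, Set.mem_union, Set.mem_compl_iff, imp_iff_not_or]
    rw [this]
    exact h1.compl.union h2
  have hgm : Measurable (Prod.map (fun ω => (xbar ω, N ω)) fun ω (k : ℕ) => w (k + 1) ω) :=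
    hxN.prodMap hwm
  -- Optimality concerns a frozen initial state with only the noise random: for almost every `ω` the
  -- claim holds for almost every independent noise sample `ω'`.
  have h1 : ∀ᵐ p ∂(μ.prod μ), Prod.map (fun ω => (xbar ω, N ω))
      (fun ω (k : ℕ) => w (k + 1) ω) p ∈ A := by
    refine (Measure.ae_prod_mem_iff_ae_ae_mem (hgm hAm)).2 ?_
    filter_upwards [hopt] with ω hω
    by_cases hNk : N ω = k
    · rw [hNk] at hω
      filter_upwards [hω.control_eq_feedback hw hQ hR hk] with ω' hω' _ t ht
      rw [Prod.map_apply, hct, hst]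
      exact hω' t ht
    · exact Filter.Eventually.of_forall fun ω' h => absurd h hNk
  -- By independence the actual joint law is the product law, so the claim passes to `ω' = ω`.
  have h2 : ∀ᵐ p ∂(μ.map fun ω => ((xbar ω, N ω), fun k : ℕ => w (k + 1) ω)), p ∈ A := by
    rw [(indepFun_iff_map_prod_eq_prod_map_map hxN.aemeasurable hwm.aemeasurable).1 hind,
      Measure.map_prod_map _ _ hxN hwm]
    exact (ae_map_iff (p := fun p => p ∈ A) hgm.aemeasurable hAm).2 h1
  filter_upwards [ae_of_ae_map (hxN.prodMk hwm).aemeasurable h2] with ω hω hNk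
  have := S.trajectory_eq (k := k) (x₁ := xbar ω) (pol := π k (xbar ω)) (fb := fb)
    (w := fun s => w s ω) fun t ht => by
      have := hω hNk t ht
      rwa [hct, hst] at this
  simp only [LinSys.agentState, LinSys.agentControl, hNk]
  exact this
/-! ### Disintegration over the horizon -/

/-- Valid also for horizons of probability zero, where both sides vanish, so sums over the horizon
need no case distinction. -/
theorem restrict_horizon [IsProbabilityMeasure μ] (N : Ω → ℕ) (k : ℕ) :
    μ.restrict {ω | N ω = k} = μ {ω | N ω = k} • condHorizon μ N k := by
  rw [condHorizon, ProbabilityTheory.cond, smul_smul]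
  by_cases h0 : μ {ω | N ω = k} = 0
  · rw [Measure.restrict_eq_zero.2 h0, smul_zero]
  · rw [ENNReal.mul_inv_cancel h0 (measure_ne_top _ _), one_smul]

theorem mul_integral_condHorizon [IsProbabilityMeasure μ] (N : Ω → ℕ) (k : ℕ) (f : Ω → ℝ) :
    μ.real {ω | N ω = k} * ∫ ω, f ω ∂(condHorizon μ N k) = ∫ ω in {ω | N ω = k}, f ω ∂μ := by
  rw [restrict_horizon, integral_smul_measure, smul_eq_mul]; rfl

theorem HorizonAssumption.iUnion_mem {ν : ℕ} {N : Ω → ℕ} (hN : HorizonAssumption n ν μ N) :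
    ∀ᵐ ω ∂μ, ω ∈ ⋃ k ∈ Finset.Icc 2 ν, {ω | N ω = k} := by
  filter_upwards [hN.support] with ω hω
  simpa using hω

theorem HorizonAssumption.integrable [IsProbabilityMeasure μ] {ν : ℕ} {N : Ω → ℕ}
    (hN : HorizonAssumption n ν μ N) {f : Ω → ℝ}
    (hf : ∀ k ∈ Finset.Icc 2 ν, Integrable f (condHorizon μ N k)) : Integrable f μ := by
  rw [← Measure.restrict_eq_self_of_ae_mem hN.iUnion_mem]
  refine integrableOn_finset_iUnion.2 fun k hk => ?_
  rw [IntegrableOn, restrict_horizon]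
  exact (hf k hk).smul_measure (measure_ne_top _ _)

theorem HorizonAssumption.integral_eq_sum [IsProbabilityMeasure μ] {ν : ℕ} {N : Ω → ℕ}
    (hN : HorizonAssumption n ν μ N) {f : Ω → ℝ} (hf : Integrable f μ) :
    ∫ ω, f ω ∂μ = ∑ k ∈ Finset.Icc 2 ν,
      μ.real {ω | N ω = k} * ∫ ω, f ω ∂(condHorizon μ N k) := by
  simp_rw [mul_integral_condHorizon]
  conv_lhs => rw [← Measure.restrict_eq_self_of_ae_mem hN.iUnion_mem]
  refine integral_biUnion_finset _ (fun k _ => hN.measurable (measurableSet_singleton k)) ?_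
    fun k _ => hf.integrableOn
  intro i _ j _ hij
  exact Set.disjoint_left.2 fun ω h1 h2 => hij (h1.symm.trans h2)

/-- For `n = 0` the bound `n + 1 ≤ ν` is too weak; nonemptiness of the horizon's range is what gives
this. -/
theorem HorizonAssumption.two_le [IsProbabilityMeasure μ] {ν : ℕ} {N : Ω → ℕ}
    (hN : HorizonAssumption n ν μ N) : 2 ≤ ν := by
  obtain ⟨ω, hω⟩ := hN.support.exists
  rw [Finset.mem_Icc] at hω
  omega

/-! ### The objective along a closed loop -/

namespace LinSys.ClosedLoop

variable {S : LinSys n m} {xbar : Ω → Fin n → ℝ} {w v : ℕ → Ω → Fin n → ℝ}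
  {SigW SigV : Matrix (Fin n) (Fin n) ℝ} {k : ℕ} {pol : Policy n m}

theorem memLp_observation [IsProbabilityMeasure μ] (h : S.ClosedLoop μ xbar w SigW k pol)
    (hv : IsIIDNoise μ v SigV) {t : ℕ} (h1 : 1 ≤ t) (ht : t ≤ S.ν) :
    MemLp (fun ω => S.state k (xbar ω) pol (fun s => w s ω) t + v t ω) 2 μ :=
  (h.memLp_state ht).add (hv.memLp t h1)

end LinSys.ClosedLoop

theorem LinSys.psi_eq (S : LinSys n m) (SigW SigV : Matrix (Fin n) (Fin n) ℝ) (k : ℕ)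
    (z : Candidate n) (y : ℕ → Fin n → ℝ) :
    S.psi SigW SigV k z y = quadFun (z.P S.ν) (z.η S.ν) (y S.ν)
      - quadFun (z.P (S.ν - k + 1)) (z.η (S.ν - k + 1)) (y (S.ν - k + 1))
      + ∑ t ∈ Finset.Icc (S.ν - k + 1) (S.ν - 1), quadFun z.Q z.q (y t)
      + (∑ t ∈ Finset.Icc (S.ν - k + 1) (S.ν - 1),
        ((1 / 2) * z.ξ t - (1 / 2) * (z.P (t + 1) * Matrix.vecMulVec S.d S.d).trace
          - z.η (t + 1) ⬝ᵥ S.d - (1 / 2) * (z.P (t + 1) * SigW).trace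
          - (1 / 2) * (z.Q * SigV).trace)
        - (1 / 2) * (z.P S.ν * SigV).trace + (1 / 2) * (z.P (S.ν - k + 1) * SigV).trace) := by
  have e : ∀ t, (1 / 2) * z.ξ t - (1 / 2) * (z.P (t + 1) * Matrix.vecMulVec S.d S.d).trace
          - z.η (t + 1) ⬝ᵥ S.d + (1 / 2) * (y t ⬝ᵥ z.Q *ᵥ y t) + z.q ⬝ᵥ y t
          - (1 / 2) * (z.P (t + 1) * SigW).trace - (1 / 2) * (z.Q * SigV).trace =
      quadFun z.Q z.q (y t) + ((1 / 2) * z.ξ t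
          - (1 / 2) * (z.P (t + 1) * Matrix.vecMulVec S.d S.d).trace
          - z.η (t + 1) ⬝ᵥ S.d - (1 / 2) * (z.P (t + 1) * SigW).trace
          - (1 / 2) * (z.Q * SigV).trace) := fun t => by rw [quadFun]; ring
  rw [LinSys.psi, Finset.sum_congr rfl fun t _ => e t, Finset.sum_add_distrib, quadFun, quadFun]
  ring

theorem LinSys.integrable_psi [IsProbabilityMeasure μ] (S : LinSys n m)
    (SigW SigV : Matrix (Fin n) (Fin n) ℝ) {k : ℕ} (hk : k ∈ Finset.Icc 2 S.ν) (z : Candidate n)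
    {y : ℕ → Ω → Fin n → ℝ} (hy : ∀ t ∈ Finset.Icc 1 S.ν, MemLp (y t) 2 μ) :
    Integrable (fun ω => S.psi SigW SigV k z (fun t => y t ω)) μ := by
  rw [Finset.mem_Icc] at hk
  simp_rw [S.psi_eq]
  refine (((integrable_quadFun _ _ (hy _ (by simp only [Finset.mem_Icc]; omega))).sub
    (integrable_quadFun _ _ (hy _ (by simp only [Finset.mem_Icc]; omega)))).add
    (integrable_finsetSum _ fun t ht => integrable_quadFun _ _ (hy _ ?_))).add
      (integrable_const _)
  simp only [Finset.mem_Icc] at ht ⊢; omega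

/-- The expected objective is the expected quadratic form minus the control effort. -/
theorem LinSys.ClosedLoop.integral_psi [IsProbabilityMeasure μ] {S : LinSys n m}
    {xbar : Ω → Fin n → ℝ} {w v : ℕ → Ω → Fin n → ℝ} {SigW SigV : Matrix (Fin n) (Fin n) ℝ}
    {k : ℕ} {pol : Policy n m} (h : S.ClosedLoop μ xbar w SigW k pol) (hv : IsIIDNoise μ v SigV)
    (hx : IndepFun xbar
      (fun ω => ((fun k : ℕ => w (k + 1) ω), (fun k : ℕ => v (k + 1) ω))) μ)
    (hwv : IndepFun (fun ω (k : ℕ) => w (k + 1) ω) (fun ω (k : ℕ) => v (k + 1) ω) μ)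
    {z : Candidate n} (hQ : z.Q.IsSymm) (hP : ∀ t ∈ Finset.Icc 1 S.ν, (z.P t).IsSymm) :
    let x := fun t ω => S.state k (xbar ω) pol (fun s => w s ω) t
    let u := fun t ω => S.control k (xbar ω) pol (fun s => w s ω) t
    ∫ ω, S.psi SigW SigV k z (fun t => x t ω + v t ω) ∂μ =
      ∑ t ∈ Finset.Icc (S.ν - k + 1) (S.ν - 1),
        (1 / 2) * ∫ ω, S.stageForm z t (u t ω) (x t ω) ∂μ
      - ∑ t ∈ Finset.Icc (S.ν - k + 1) (S.ν - 1), (1 / 2) * ∫ ω, u t ω ⬝ᵥ u t ω ∂μ := by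
  intro x u
  have hk := Finset.mem_Icc.1 h.horizon
  have htel := h.integral_telescope z hP
  -- Measurement noise biases each quadratic term by `tr(M SigV)/2`, precisely what the trace
  -- corrections in the objective subtract.
  have hobs : ∀ (M : Matrix (Fin n) (Fin n) ℝ) (e : Fin n → ℝ), M.IsSymm → ∀ t, 1 ≤ t →
      t ≤ S.ν → ∫ ω, quadFun M e (x t ω + v t ω) ∂μ =
        ∫ ω, quadFun M e (x t ω) ∂μ + (1 / 2) * (M * SigV).trace := fun M e hM t h1 h2 =>
    integral_quadFun_add_noise hM e (h.memLp_state h2) (hv.memLp t h1) (hv.mean t h1)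
      (hv.cov t h1) (h.indepFun_measurementNoise hv hx hwv h1 h2)
  have hi : ∀ (M : Matrix (Fin n) (Fin n) ℝ) (e : Fin n → ℝ) (t : ℕ), 1 ≤ t → t ≤ S.ν →
      Integrable (fun ω => quadFun M e (x t ω + v t ω)) μ := fun M e t h1 h2 =>
    integrable_quadFun M e (h.memLp_observation hv h1 h2)
  have hT : ∀ t ∈ Finset.Icc (S.ν - k + 1) (S.ν - 1), 1 ≤ t ∧ t ≤ S.ν := fun t ht => by
    rw [Finset.mem_Icc] at ht; omega
  have i1 := hi (z.P S.ν) (z.η S.ν) S.ν (by omega) le_rfl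
  have i2 := hi (z.P (S.ν - k + 1)) (z.η (S.ν - k + 1)) (S.ν - k + 1) (by omega) (by omega)
  have i3 : Integrable (fun ω => ∑ t ∈ Finset.Icc (S.ν - k + 1) (S.ν - 1),
      quadFun z.Q z.q (x t ω + v t ω)) μ :=
    integrable_finsetSum _ fun t ht => hi _ _ t (hT t ht).1 (hT t ht).2
  have i12 : Integrable (fun ω => quadFun (z.P S.ν) (z.η S.ν) (x S.ν ω + v S.ν ω)
      - quadFun (z.P (S.ν - k + 1)) (z.η (S.ν - k + 1))
        (x (S.ν - k + 1) ω + v (S.ν - k + 1) ω)) μ := i1.sub i2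
  have i123 : Integrable (fun ω => quadFun (z.P S.ν) (z.η S.ν) (x S.ν ω + v S.ν ω)
      - quadFun (z.P (S.ν - k + 1)) (z.η (S.ν - k + 1))
        (x (S.ν - k + 1) ω + v (S.ν - k + 1) ω)
      + ∑ t ∈ Finset.Icc (S.ν - k + 1) (S.ν - 1), quadFun z.Q z.q (x t ω + v t ω)) μ :=
    i12.add i3
  simp_rw [S.psi_eq]
  rw [integral_add i123 (integrable_const _), integral_add i12 i3, integral_sub i1 i2,
    integral_finsetSum _ fun t ht => hi _ _ t (hT t ht).1 (hT t ht).2,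
    hobs _ _ (hP _ (by simp only [Finset.mem_Icc]; omega)) _ (by omega) le_rfl,
    hobs _ _ (hP _ (by simp only [Finset.mem_Icc]; omega)) _ (by omega) (by omega),
    Finset.sum_congr rfl fun t ht => hobs z.Q z.q hQ t (hT t ht).1 (hT t ht).2]
  simp only [integral_const, probReal_univ, one_smul]
  simp only [Finset.sum_sub_distrib, Finset.sum_add_distrib] at htel ⊢
  linarith

/-! ### Persistence of excitation along the closed loop -/

/-- No nonzero affine function vanishes almost surely at `X`. -/
def AffinelyRich (μ : Measure Ω) (X : Ω → Fin n → ℝ) : Prop :=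
  ∀ (a : Fin n → ℝ) (b : ℝ), (∀ᵐ ω ∂μ, a ⬝ᵥ X ω + b = 0) → a = 0 ∧ b = 0

theorem AffinelyRich.eq_zero {X : Ω → Fin n → ℝ} (h : AffinelyRich μ X) {l : ℕ}
    {M : Matrix (Fin l) (Fin n) ℝ} {c : Fin l → ℝ} (hM : ∀ᵐ ω ∂μ, M *ᵥ X ω + c = 0) :
    M = 0 ∧ c = 0 := by
  have key : ∀ i, M i = 0 ∧ c i = 0 := fun i => h (M i) (c i) <| by
    filter_upwards [hM] with ω hω
    exact congrFun hω i
  exact ⟨funext fun i => (key i).1, funext fun i => (key i).2⟩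

/-- If `Y = -W` almost surely, then `E Y² = -E[Y W] = -E[Y] E[W] = 0`. -/
theorem ae_eq_zero_of_add_indepFun {Y W : Ω → ℝ} (hY : MemLp Y 2 μ)
    (hW : MemLp W 2 μ) (hind : IndepFun Y W μ) (hmean : ∫ ω, W ω ∂μ = 0)
    (h : ∀ᵐ ω ∂μ, Y ω + W ω = 0) : ∀ᵐ ω ∂μ, Y ω = 0 := by
  have h1 : ∫ ω, Y ω ^ 2 ∂μ = -∫ ω, Y ω * W ω ∂μ := by
    rw [← integral_neg]
    refine integral_congr_ae ?_
    filter_upwards [h] with ω hω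
    rw [eq_neg_of_add_eq_zero_right hω]; ring
  rw [hind.integral_fun_mul_eq_mul_integral hY.aestronglyMeasurable hW.aestronglyMeasurable,
    hmean, mul_zero, neg_zero, integral_eq_zero_iff_of_nonneg (fun ω => sq_nonneg _)
    hY.integrable_sq] at h1
  filter_upwards [h1] with ω hω
  simpa using hω

/-- An affine relation for the next state splits into an affine function of the current state plus
independent centred noise. The former must vanish by itself, and the invertible closed-loop matrix
carries the triviality of its coefficients forward. -/
theorem LinSys.ClosedLoop.affinelyRich_state [IsProbabilityMeasure μ] {S : LinSys n m}
    {xbar : Ω → Fin n → ℝ} {w : ℕ → Ω → Fin n → ℝ} {SigW : Matrix (Fin n) (Fin n) ℝ}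
    {pol : Policy n m} (h : S.ClosedLoop μ xbar w SigW S.ν pol)
    {K : ℕ → Matrix (Fin m) (Fin n) ℝ} {κ : ℕ → Fin m → ℝ}
    (hpol : ∀ t x, pol t x = K t *ᵥ x + κ t)
    (hK : ∀ t ∈ Finset.Icc 1 (S.ν - 1), IsUnit (S.A + S.B * K t)) (hx : AffinelyRich μ xbar)
    {t : ℕ} (ht1 : 1 ≤ t) (ht : t ≤ S.ν) :
    AffinelyRich μ fun ω => S.state S.ν (xbar ω) pol (fun s => w s ω) t := by
  induction t, ht1 using Nat.le_induction with
  | base => simpa only [S.state_initial S.ν _ pol _ (show 1 ≤ S.ν - S.ν + 1 by omega)] using hx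
  | succ t ht1 ih =>
    intro a b hab
    have hst := h.memLp_state (t := t) (by omega)
    have hwt := h.noise.memLp t ht1
    have ha : (S.A + S.B * K t)ᵀ *ᵥ a = 0 ∧ a ⬝ᵥ (S.B *ᵥ κ t + S.d) + b = 0 := by
      refine ih (by omega) _ _ ?_
      refine ae_eq_zero_of_add_indepFun (W := fun ω => a ⬝ᵥ w t ω)
        ?_ ?_ ?_ ?_ ?_
      · exact (memLp_finsetSum _ fun i _ => (hst.eval i).const_mul _).add (memLp_const _)
      · exact memLp_finsetSum _ fun i _ => (hwt.eval i).const_mul _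
      · have hm : ∀ e : Fin n → ℝ, Measurable fun y : Fin n → ℝ => e ⬝ᵥ y := fun e =>
          (continuous_const.dotProduct continuous_id).measurable
        exact (h.indepFun_noise ht1 (by omega)).comp ((hm _).add_const _) (hm a)
      · simp only [dotProduct]
        rw [integral_finsetSum _ fun i _ => ((hwt.eval i).integrable (by norm_num)).const_mul _]
        refine Finset.sum_eq_zero fun i _ => ?_
        rw [integral_const_mul, ← eval_integral
          (fun i => (hwt.eval i).integrable (by norm_num)), h.noise.mean t ht1]
        simp
      · filter_upwards [hab] with ω hω
        rw [S.state_succ _ _ _ _ (by omega), S.control_active _ _ _ _ (by omega), hpol] at hω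
        rw [transpose_mulVec_dotProduct, ← hω, add_mulVec, ← mulVec_mulVec]
        simp only [mulVec_add, dotProduct_add]
        ring
    have hU : IsUnit (S.A + S.B * K t)ᵀ := by
      have := hK t (by simp only [Finset.mem_Icc]; omega)
      rwa [Matrix.isUnit_iff_isUnit_det, det_transpose, ← Matrix.isUnit_iff_isUnit_det]
    have ha0 : a = 0 := Matrix.mulVec_injective_of_isUnit hU (by simpa using ha.1)
    exact ⟨ha0, by simpa [ha0] using ha.2⟩

/-- If `H t` vanishes along the closed loop almost surely, it vanishes along the feedback. -/
theorem AffinelyRich.tight {S : LinSys n m} {X : Ω → Fin n → ℝ} (h : AffinelyRich μ X)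
    {z : Candidate n} {t : ℕ} {K : Matrix (Fin m) (Fin n) ℝ} {κ : Fin m → ℝ}
    (hae : ∀ᵐ ω ∂μ, S.Tight z t (K *ᵥ X ω + κ) (X ω)) (x : Fin n → ℝ) :
    S.Tight z t (K *ᵥ x + κ) x := by
  have e1 : ∀ y, (S.fR 1 (z.P (t + 1)) * K + S.fS (z.P (t + 1))) *ᵥ y
      + (S.fR 1 (z.P (t + 1)) *ᵥ κ + S.g (z.P (t + 1)) (z.η (t + 1))) =
      S.fR 1 (z.P (t + 1)) *ᵥ (K *ᵥ y + κ) + S.fS (z.P (t + 1)) *ᵥ y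
        + S.g (z.P (t + 1)) (z.η (t + 1)) := fun y => by
    rw [add_mulVec, ← mulVec_mulVec, mulVec_add]; abel
  have e2 : ∀ y, ((S.fS (z.P (t + 1)))ᵀ * K + (S.Aᵀ * z.P (t + 1) * S.A + z.Q - z.P t)) *ᵥ y
      + ((S.fS (z.P (t + 1)))ᵀ *ᵥ κ + S.β z t) =
      (S.fS (z.P (t + 1)))ᵀ *ᵥ (K *ᵥ y + κ)
        + (S.Aᵀ * z.P (t + 1) * S.A + z.Q - z.P t) *ᵥ y + S.β z t := fun y => by
    rw [add_mulVec, ← mulVec_mulVec, mulVec_add]; abel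
  have e3 : ∀ y, (Kᵀ *ᵥ S.g (z.P (t + 1)) (z.η (t + 1)) + S.β z t) ⬝ᵥ y
      + (S.g (z.P (t + 1)) (z.η (t + 1)) ⬝ᵥ κ + z.ξ t) =
      S.g (z.P (t + 1)) (z.η (t + 1)) ⬝ᵥ (K *ᵥ y + κ) + S.β z t ⬝ᵥ y + z.ξ t := fun y => by
    rw [add_dotProduct, transpose_mulVec_dotProduct, dotProduct_add]; ring
  refine ⟨?_, ?_, ?_⟩
  · have := h.eq_zero (hae.mono fun ω hω => (e1 (X ω)).trans hω.row_u)
    rw [← e1, this.1, this.2, zero_mulVec, zero_add]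
  · have := h.eq_zero (hae.mono fun ω hω => (e2 (X ω)).trans hω.row_x)
    rw [← e2, this.1, this.2, zero_mulVec, zero_add]
  · have := h _ _ (hae.mono fun ω hω => (e3 (X ω)).trans hω.row_one)
    rw [← e3, this.1, this.2, zero_dotProduct, zero_add]

/-! ### Feasibility of the true point and the proof of the theorem -/

theorem LinSys.truth_isFeasible (S : LinSys n m) {Q : Matrix (Fin n) (Fin n) ℝ} (hQ : Q.IsSymm)
    (q : Fin n → ℝ)
    (hR : ∀ t ∈ Finset.Icc 1 (S.ν - 1), (S.fR 1 ((S.truth Q q).P (t + 1))).PosDef) :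
    ∃ φ₀ : ℝ, ∀ φ, φ₀ ≤ φ → S.IsFeasible φ (S.truth Q q) := by
  obtain ⟨M₁, h₁⟩ := ((Finset.Icc 1 S.ν).image fun t => frobNorm ((S.truth Q q).P t)).exists_le
  obtain ⟨M₂, h₂⟩ := ((Finset.Icc 1 S.ν).image fun t => l2norm ((S.truth Q q).η t)).exists_le
  obtain ⟨M₃, h₃⟩ := ((Finset.Icc 1 (S.ν - 1)).image fun t => |(S.truth Q q).ξ t|).exists_le
  simp only [Finset.forall_mem_image] at h₁ h₂ h₃
  -- The summands `1` turn the maxima for `η` and `ξ` into strict bounds.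
  refine ⟨max (frobNorm (Matrix.fromBlocks Q (Matrix.replicateCol Unit q)
    (Matrix.replicateRow Unit q) 0)) (max M₁ (max (M₂ + 1) (M₃ + 1))), fun φ hφ => ?_⟩
  simp only [max_le_iff] at hφ
  obtain ⟨h0, hM₁, hM₂, hM₃⟩ := hφ
  exact
    { param := ⟨hQ, h0⟩
      P_symm := fun t _ => S.truth_P_isSymm hQ q t
      P_le := fun t ht => (h₁ ht).trans hM₁
      η_lt := fun t ht => (h₂ ht).trans_lt (by linarith)
      ξ_lt := fun t ht => (h₃ ht).trans_lt (by linarith)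
      P_last := S.truth_P_last Q q
      η_last := S.truth_η_last Q q
      H_psd := fun t ht => S.truth_H_posSemidef hQ q
        (by rw [Finset.mem_Icc] at ht; omega) (hR t ht) }
theorem LinSys.psi_congr (S : LinSys n m) (SigW SigV : Matrix (Fin n) (Fin n) ℝ) {k : ℕ}
    (hk : k ∈ Finset.Icc 2 S.ν) (z : Candidate n) {y y' : ℕ → Fin n → ℝ}
    (h : ∀ t ≤ S.ν, y t = y' t) : S.psi SigW SigV k z y = S.psi SigW SigV k z y' := by
  rw [Finset.mem_Icc] at hk
  rw [S.psi_eq, S.psi_eq, h _ le_rfl, h (S.ν - k + 1) (by omega),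
    Finset.sum_congr rfl fun t ht => by
      rw [h t (by simp only [Finset.mem_Icc] at ht; omega)]]

/-- The expected control effort given the horizon; the controls vanish before the start. -/
theorem LinSys.sum_control (S : LinSys n m) {k : ℕ} (xbar : Ω → Fin n → ℝ) (pol : Policy n m)
    (w : ℕ → Ω → Fin n → ℝ) :
    ∑ t ∈ Finset.Icc 1 (S.ν - 1), (1 / 2) *
      ∫ ω, S.control k (xbar ω) pol (fun s => w s ω) t ⬝ᵥ
        S.control k (xbar ω) pol (fun s => w s ω) t ∂μ =
    ∑ t ∈ Finset.Icc (S.ν - k + 1) (S.ν - 1), (1 / 2) *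
      ∫ ω, S.control k (xbar ω) pol (fun s => w s ω) t ⬝ᵥ
        S.control k (xbar ω) pol (fun s => w s ω) t ∂μ := by
  refine (Finset.sum_subset (Finset.Icc_subset_Icc_left (by omega)) fun t ht hnt => ?_).symm
  have : t ≤ S.ν - k := by simp only [Finset.mem_Icc] at ht hnt; omega
  simp only [S.control_initial _ _ _ _ this, dotProduct_zero, integral_zero, mul_zero]

end IOC

theorem mainTheorem3 {n m : ℕ} (S : IOC.LinSys n m)
    {Ω : Type*} [MeasurableSpace Ω] (P : Measure Ω) [IsProbabilityMeasure P]
    (xbar : Ω → Fin n → ℝ) (N : Ω → ℕ) (w v : ℕ → Ω → Fin n → ℝ)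
    (SigW SigV : Matrix (Fin n) (Fin n) ℝ)
    (Qbar : Matrix (Fin n) (Fin n) ℝ) (qbar : Fin n → ℝ)
    -- controllability and full rank
    (hctrl : S.IsControllable) (hA : IsUnit S.A) (hB : S.B.rank = m)
    -- i.i.d. noises, independent of the initial state and the horizon
    (hw : IOC.IsIIDNoise P w SigW) (hv : IOC.IsIIDNoise P v SigV)
    (hind : IOC.MutuallyIndependent P xbar N w v)
    -- support of the planning horizon and persistent excitation
    (hN : IOC.HorizonAssumption n S.ν P N)
    (hx : IOC.PersistentExcitation S.ν P xbar N)
    -- the true parameters, and the optimal strategies that the agent uses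
    (htrue : (Qbar, qbar) ∈ S.wellPosed P w xbar 1)
    (π : ℕ → (Fin n → ℝ) → IOC.Policy n m)
    (hπ : ∀ k t, Measurable (fun p : (Fin n → ℝ) × (Fin n → ℝ) => π k p.1 t p.2))
    (hopt : ∀ᵐ ω ∂P, S.IsOptimal P w Qbar qbar 1 (N ω) (xbar ω) (π (N ω) (xbar ω))) :
    let u := S.agentControl π xbar N w
    let y := S.observation π xbar N w v
    let Ψ := S.Psi P N SigW SigV y
    let lowerBound := - ∑ t ∈ Finset.Icc 1 (S.ν - 1), ∫ ω, (1 / 2) * IOC.l2norm (u t ω) ^ 2 ∂P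
    let zbar := S.truth Qbar qbar
    -- all expectations below are expectations of integrable random variables
    (∀ t ∈ Finset.Icc 1 (S.ν - 1), Integrable (fun ω => IOC.l2norm (u t ω) ^ 2) P) ∧
    (∀ k ∈ Finset.Icc 2 S.ν, ∀ z : IOC.Candidate n,
      Integrable (fun ω => S.psi SigW SigV k z (fun t => y t ω)) (IOC.condHorizon P N k)) ∧
    -- the lower bound on the feasible set
    (∀ φ : ℝ, ∀ z : IOC.Candidate n, S.IsFeasible φ z → lowerBound ≤ Ψ z) ∧
    -- for large `φ` the true point attains it and is the unique global minimizer
    ∃ φ₀ : ℝ, ∀ φ : ℝ, φ₀ ≤ φ →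
      S.IsFeasible φ zbar ∧ Ψ zbar = lowerBound ∧
      ∀ z : IOC.Candidate n, S.IsFeasible φ z → Ψ z ≤ Ψ zbar → z.Same S.ν zbar := by
  intro u y Ψ lowerBound zbar
  have hQ : Qbar.IsSymm := htrue.1
  have hν2 := hN.two_le
  have hR := S.truth_fR_posDef hA hw hN hν2 hx htrue
  have hwm := hw.measurable_shift
  have hvm := hv.measurable_shift
  have hxN_w : IndepFun (fun ω => (xbar ω, N ω)) (fun ω (k : ℕ) => w (k + 1) ω) P :=
    hind.1.comp measurable_id measurable_fst
  have hagent : ∀ k ∈ Finset.Icc 2 S.ν, _ := fun k hk =>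
    S.agent_eq_feedback hw hx.measurable hN.measurable hxN_w hQ hR hπ hopt hk
  let fb := S.feedback zbar
  let xs : ℕ → ℕ → Ω → Fin n → ℝ := fun k t ω => S.state k (xbar ω) fb (fun s => w s ω) t
  let us : ℕ → ℕ → Ω → Fin m → ℝ := fun k t ω => S.control k (xbar ω) fb (fun s => w s ω) t
  -- the conditional laws given the horizons of positive probability
  have hprob : ∀ k, P {ω | N ω = k} ≠ 0 → IsProbabilityMeasure (IOC.condHorizon P N k) :=
    fun k hk => cond_isProbabilityMeasure hk
  have hzero : ∀ k, P {ω | N ω = k} = 0 → IOC.condHorizon P N k = 0 := fun k hk =>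
    cond_eq_zero_of_meas_eq_zero hk
  have hcond : ∀ k, P {ω | N ω = k} ≠ 0 →
      IndepFun xbar (fun ω => ((fun k : ℕ => w (k + 1) ω), (fun k : ℕ => v (k + 1) ω)))
        (IOC.condHorizon P N k) ∧
      IOC.IsIIDNoise (IOC.condHorizon P N k) w SigW ∧
      IOC.IsIIDNoise (IOC.condHorizon P N k) v SigV ∧
      IndepFun (fun ω (k : ℕ) => w (k + 1) ω) (fun ω (k : ℕ) => v (k + 1) ω)
        (IOC.condHorizon P N k) := by
    intro k hk
    have := hprob k hk
    obtain ⟨h1, h2⟩ := IOC.indepFun_cond hN.measurable (hwm.prodMk hvm) hind.1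
      (pos_iff_ne_zero.2 hk)
    have hid := IOC.identDistrib_of_map_eq (hwm.prodMk hvm) h2
    have hidw := (hid.comp measurable_fst).map_eq
    have hidv := (hid.comp measurable_snd).map_eq
    simp only [Function.comp_def] at hidw hidv
    refine ⟨h1, hw.of_map_eq hidw, hv.of_map_eq hidv, ?_⟩
    rw [indepFun_iff_map_prod_eq_prod_map_map hwm.aemeasurable hvm.aemeasurable, h2, hidw, hidv]
    exact (indepFun_iff_map_prod_eq_prod_map_map hwm.aemeasurable hvm.aemeasurable).1 hind.2
  -- The agent's strategy depends on the initial state, whereas this closed loop runs one fixed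
  -- feedback; `hae` identifies the two almost surely.
  have hloop : ∀ k ∈ Finset.Icc 2 S.ν, P {ω | N ω = k} ≠ 0 →
      S.ClosedLoop (IOC.condHorizon P N k) xbar w SigW k fb := by
    intro k hk h0
    have := hprob k h0
    obtain ⟨h1, h2, -, -⟩ := hcond k h0
    refine S.closedLoop_of_affine hk hx.measurable ?_ h2 (h1.comp measurable_id measurable_fst)
      fb (S.gain zbar) (S.offset zbar) (S.feedback_eq zbar)
    have hm := (hx.memLp.restrict {ω | N ω = k}).smul_measure (c := (P {ω | N ω = k})⁻¹)
      (ENNReal.inv_ne_top.2 h0)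
    exact hm
  have hae : ∀ k ∈ Finset.Icc 2 S.ν, ∀ᵐ ω ∂(IOC.condHorizon P N k),
      (∀ t ≤ S.ν, S.agentState π xbar N w t ω = xs k t ω) ∧ ∀ t < S.ν, u t ω = us k t ω := by
    intro k hk
    have h1 : ∀ᵐ ω ∂(IOC.condHorizon P N k), N ω = k :=
      ae_cond_mem (hN.measurable (measurableSet_singleton k))
    have h2 := (cond_absolutelyContinuous (μ := P) (s := {ω | N ω = k})).ae_le (hagent k hk)
    filter_upwards [h1, h2] with ω hω1 hω2
    exact hω2 hω1
  have hpsi : ∀ k ∈ Finset.Icc 2 S.ν, ∀ z : IOC.Candidate n,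
      (fun ω => S.psi SigW SigV k z (fun t => y t ω)) =ᵐ[IOC.condHorizon P N k]
        fun ω => S.psi SigW SigV k z (fun t => xs k t ω + v t ω) := by
    intro k hk z
    filter_upwards [hae k hk] with ω hω
    exact S.psi_congr SigW SigV hk z fun t ht => by
      simp only [y, IOC.LinSys.observation, hω.1 t ht]
  have hueq : ∀ k ∈ Finset.Icc 2 S.ν, ∀ t ∈ Finset.Icc 1 (S.ν - 1),
      (fun ω => IOC.l2norm (u t ω) ^ 2) =ᵐ[IOC.condHorizon P N k]
        fun ω => us k t ω ⬝ᵥ us k t ω := by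
    intro k hk t ht
    filter_upwards [hae k hk] with ω hω
    rw [IOC.l2norm_sq, hω.2 t (by simp only [Finset.mem_Icc] at ht; omega)]
  have huint : ∀ t ∈ Finset.Icc 1 (S.ν - 1), Integrable (fun ω => IOC.l2norm (u t ω) ^ 2) P := by
    intro t ht
    refine hN.integrable fun k hk => ?_
    by_cases h0 : P {ω | N ω = k} = 0
    · rw [hzero k h0]; exact integrable_zero_measure
    · refine Integrable.congr ?_ (hueq k hk t ht).symm
      by_cases hc : t ≤ S.ν - k
      · simp only [us, S.control_initial _ _ _ _ hc, dotProduct_zero]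
        exact integrable_zero _ _ _
      · have := (hloop k hk h0).memLp_control t (by simp only [Finset.mem_Icc] at *; omega)
        exact IOC.integrable_dotProduct this this
  -- the objective is the lower bound plus the expected quadratic forms
  let excess : IOC.Candidate n → ℕ → ℝ := fun z k =>
    ∑ t ∈ Finset.Icc (S.ν - k + 1) (S.ν - 1),
      (1 / 2) * ∫ ω, S.stageForm z t (us k t ω) (xs k t ω) ∂(IOC.condHorizon P N k)
  have hΨ : ∀ z : IOC.Candidate n, z.Q.IsSymm → (∀ t ∈ Finset.Icc 1 S.ν, (z.P t).IsSymm) →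
      Ψ z = ∑ k ∈ Finset.Icc 2 S.ν, P.real {ω | N ω = k} * excess z k + lowerBound := by
    intro z hzQ hzP
    have hlb : lowerBound = -∑ k ∈ Finset.Icc 2 S.ν, P.real {ω | N ω = k} *
        ∑ t ∈ Finset.Icc (S.ν - k + 1) (S.ν - 1),
          (1 / 2) * ∫ ω, us k t ω ⬝ᵥ us k t ω ∂(IOC.condHorizon P N k) := by
      simp only [lowerBound]
      congr 1
      rw [Finset.sum_congr rfl fun t ht =>
        (integral_const_mul _ _).trans (congrArg _ (hN.integral_eq_sum (huint t ht)))]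
      simp_rw [Finset.mul_sum]
      rw [Finset.sum_comm]
      refine Finset.sum_congr rfl fun k hk => ?_
      refine Eq.trans ?_ ((congrArg (P.real {ω | N ω = k} * ·)
        (S.sum_control xbar fb w)).trans (Finset.mul_sum _ _ _))
      simp only [Finset.mul_sum]
      refine Finset.sum_congr rfl fun t ht => ?_
      rw [integral_congr_ae (hueq k hk t ht)]
      simp only [us]
      ring
    rw [hlb, ← sub_eq_add_neg, ← Finset.sum_sub_distrib]
    refine Finset.sum_congr rfl fun k hk => ?_
    rw [← mul_sub]
    by_cases h0 : P {ω | N ω = k} = 0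
    · simp [Measure.real, h0]
    · have := hprob k h0
      obtain ⟨h1, -, h3, h4⟩ := hcond k h0
      rw [integral_congr_ae (hpsi k hk z)]
      congr 1
      exact (hloop k hk h0).integral_psi h3 h1 h4 hzQ hzP
  have hT : ∀ k, ∀ t ∈ Finset.Icc (S.ν - k + 1) (S.ν - 1), t ∈ Finset.Icc 1 (S.ν - 1) :=
    fun k t ht => by simp only [Finset.mem_Icc] at *; omega
  have hnn : ∀ (φ : ℝ) (z : IOC.Candidate n), S.IsFeasible φ z → ∀ k, 0 ≤ excess z k :=
    fun φ z hz k => Finset.sum_nonneg fun t ht => mul_nonneg (by norm_num)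
      (integral_nonneg fun ω => S.stageForm_nonneg (hz.H_psd t (hT k t ht)) _ _)
  have hform0 : ∀ k, ∀ t ∈ Finset.Icc (S.ν - k + 1) (S.ν - 1), ∀ ω,
      S.stageForm zbar t (us k t ω) (xs k t ω) = 0 := by
    intro k t ht ω
    have ht' := Finset.mem_Icc.1 ht
    simp only [us, xs, S.control_active _ _ _ _ ht'.1]
    exact S.truth_stageForm_feedback hQ qbar (by omega) (hR t (hT k t ht)) _
  have hexc0 : ∀ k, excess zbar k = 0 := fun k => Finset.sum_eq_zero fun t ht => by
    simp only [hform0 k t ht, integral_zero, mul_zero]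
  have hΨbar : Ψ zbar = lowerBound := by
    rw [hΨ zbar hQ fun t _ => S.truth_P_isSymm hQ qbar t]
    simp [hexc0]
  refine ⟨huint, ?_, ?_, ?_⟩
  · intro k hk z
    by_cases h0 : P {ω | N ω = k} = 0
    · rw [hzero k h0]; exact integrable_zero_measure
    · have := hprob k h0
      refine Integrable.congr (S.integrable_psi SigW SigV hk z fun t ht => ?_) (hpsi k hk z).symm
      rw [Finset.mem_Icc] at ht
      exact (hloop k hk h0).memLp_observation (hcond k h0).2.2.1 ht.1 ht.2
  · intro φ z hz
    rw [hΨ z hz.param.1 hz.P_symm]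
    exact le_add_of_nonneg_left (Finset.sum_nonneg fun k _ =>
      mul_nonneg measureReal_nonneg (hnn φ z hz k))
  · obtain ⟨φ₀, hφ₀⟩ := S.truth_isFeasible hQ qbar hR
    refine ⟨φ₀, fun φ hφ => ⟨hφ₀ φ hφ, hΨbar, fun z hz hle => ?_⟩⟩
    rw [hΨbar, hΨ z hz.param.1 hz.P_symm] at hle
    have hνI : S.ν ∈ Finset.Icc 2 S.ν := Finset.mem_Icc.2 ⟨hν2, le_rfl⟩
    have hν0 : P {ω | N ω = S.ν} ≠ 0 := hN.pos.ne'
    have := hprob S.ν hν0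
    have hcl := hloop S.ν hνI hν0
    have hterms : ∀ k ∈ Finset.Icc 2 S.ν, 0 ≤ P.real {ω | N ω = k} * excess z k :=
      fun k _ => mul_nonneg measureReal_nonneg (hnn φ z hz k)
    -- The longest horizon has positive probability, so its excess must vanish; on it all times `1,
    -- …, ν - 1` are active.
    have hexc : excess z S.ν = 0 := by
      have := (Finset.sum_eq_zero_iff_of_nonneg hterms).1
        (le_antisymm (by linarith) (Finset.sum_nonneg hterms)) S.ν hνI
      refine (mul_eq_zero.1 this).resolve_left ?_
      exact ENNReal.toReal_ne_zero.2 ⟨hν0, measure_ne_top _ _⟩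
    have hT1 : ∀ t ∈ Finset.Icc 1 (S.ν - 1), t ∈ Finset.Icc (S.ν - S.ν + 1) (S.ν - 1) :=
      fun t ht => by simp only [Finset.mem_Icc] at *; omega
    have hrich0 : IOC.AffinelyRich (IOC.condHorizon P N S.ν) xbar :=
      fun a b hab => hx.eq_zero_of_ae hνI hN.pos hab
    have hunit : ∀ t ∈ Finset.Icc 1 (S.ν - 1), IsUnit (S.A + S.B * S.gain zbar t) := by
      intro t ht
      -- With `𝔑` definite the gain satisfies `𝔑 K + 𝔖 = 0`.
      refine S.isUnit_closedLoop hA (Pn := zbar.P (t + 1)) ?_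
      rw [IOC.LinSys.gain, Matrix.mul_neg, ← Matrix.mul_assoc, IOC.mul_pinv_of_posDef (hR t ht),
        Matrix.one_mul, neg_add_cancel]
    have htight : ∀ z' : IOC.Candidate n, (∀ t ∈ Finset.Icc 1 (S.ν - 1),
        (S.H 1 z' t).PosSemidef) → excess z' S.ν = 0 → ∀ t ∈ Finset.Icc 1 (S.ν - 1), ∀ x,
        S.Tight z' t (S.gain zbar t *ᵥ x + S.offset zbar t) x := by
      intro z' hpsd hexc' t ht
      have htI := Finset.mem_Icc.1 ht
      have hnn' : ∀ s ∈ Finset.Icc (S.ν - S.ν + 1) (S.ν - 1), 0 ≤ (1 / 2) *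
          ∫ ω, S.stageForm z' s (us S.ν s ω) (xs S.ν s ω) ∂(IOC.condHorizon P N S.ν) :=
        fun s hs => mul_nonneg (by norm_num)
          (integral_nonneg fun ω => S.stageForm_nonneg (hpsd s (hT _ s hs)) _ _)
      have h0 := ((mul_eq_zero.1 ((Finset.sum_eq_zero_iff_of_nonneg hnn').1 hexc' t
        (hT1 t ht))).resolve_left (by norm_num))
      rw [integral_eq_zero_iff_of_nonneg (fun ω => S.stageForm_nonneg (hpsd t ht) _ _)
        (S.integrable_stageForm z' t (hcl.memLp_control t (hT1 t ht))
          (hcl.memLp_state (by omega)))] at h0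
      refine (hcl.affinelyRich_state (S.feedback_eq zbar) hunit hrich0 htI.1
        (by omega)).tight ?_
      filter_upwards [h0] with ω hω
      obtain ⟨r1, r2, r3⟩ := S.stageForm_eq_zero (hpsd t ht) hω
      have hu : S.control S.ν (xbar ω) fb (fun s => w s ω) t = S.gain zbar t *ᵥ
          S.state S.ν (xbar ω) fb (fun s => w s ω) t + S.offset zbar t := by
        rw [S.control_active _ _ _ _ (Finset.mem_Icc.1 (hT1 t ht)).1]
        exact S.feedback_eq zbar t _
      rw [hu] at r1 r2 r3
      exact ⟨r1, r2, r3⟩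
    -- The competitor and the true point satisfy the kernel equations along the same affine
    -- feedback.
    exact S.same_of_tight hctrl hA hN.le hz.P_symm (fun t _ => S.truth_P_isSymm hQ qbar t)
      hz.P_last hz.η_last (S.truth_P_last Qbar qbar) (S.truth_η_last Qbar qbar)
      (S.gain zbar) (S.offset zbar) hunit (htight z hz.H_psd hexc)
      (htight zbar (hφ₀ φ hφ).H_psd (hexc0 S.ν))
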